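/- **Preparation Theorem.** Let $t\ge 0$, $T=\{1,\dots,t\}$, $\hat T=\{1,\dots,t+1\}$. *Diagrams.* A diagram $\mathscr D$ of order $t+1$ consists of columns $C_1,\dots,C_{t+1}$ of blocks standing on a common base line, of heights $ht\,C_i\in\mathbb N$; $ht\,\mathscr D$ is the maximal height. Two columns of height $\ge s$ are neighbours at level $s$ if all columns strictly between them have height $<s$. We require the boundary conditions: a column strictly higher than all columns to its left (resp. right) has even (resp. odd) height or height $ht\,\mathscr D$. The strongly extremal column is the leftmost (resp. rightmost) column of maximal height if $ht\,\mathscr D$ is odd (resp. even). A left even (resp. right odd) domino can be adjoined to $C_i$, raising its height from $s$ to $s+2$, if $s$ is even (resp. odd) and, after raising, $C_i$ is the left (resp. right) neighbour at levels $s+1$ and $s+2$ of a column of height $\ge s+2$. A diagram is complete if no such domino can be adjoined, and reduced if every positive integer $<ht\,\mathscr D$ is the height of some column. Let $H^{t+1}$ be the set of classes of diagrams for the equivalence relation generated by adjoining such dominoes, adjoining one block to the strongly extremal column, and deleting two equal adjacent rows (when the result is a diagram). The position of the strongly extremal column depends only on the class; $H^{t+1}_k$ is the set of classes for which it is $k$.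 *Entries.* The block at level $j\geq1$ of $C_i$, if it exists, is extremal if $j$ is even (resp. odd) and it is the leftmost (resp. rightmost) block of its row. Non-extremal blocks carry entries $b(i,j)\in T$: $b(i,1)=i$, and $b(i,j+1)=b(k,j)$ with $C_k$ the left (resp. right) neighbour of $C_i$ at level $j$ for $j$ odd (resp. even). Put also $b(i,0)=i-1$ for $i\ge 2$. For $1\le j\le ht\,\mathscr D$ and neighbours $C_p,C_q$ ($p<q$) at level $j$, let $p<x_1<\dots<x_n<q$ be the positions of the columns of height $j-1$ between them. If $j$ is even, impose $c_{b(x,j-1)}>c_{b(q,j)}$ for all $x$ in the list $p,x_1,\dots,x_n$ except its last element; if $j$ is odd, impose $c_{b(x,j-1)}>c_{b(p,j)}$ for all $x$ in the list $x_1,\dots,x_n,q$ except its first element. Let $P(\mathscr D)$ denote this set of inequalities. *Functions.* Let $c_i$ $(i\in T)$, $m^i$ $(i\in\hat T)$ be indeterminates and let $r^i$ be such that $r^i-r^{i+1}=m^i+m^{i+1}$. Put $$f_{\mathscr D}=-\sum_{i\in T}c_im^i+\sum_{s=1}^{ht\,\mathscr D} f_{R_s},$$ where $f_{R_s}$ is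 the sum over all pairs $p<q$ of neighbours at level $s$ of $c_{b(p,s)}(r^p-r^q)$ if $s$ is odd, and of $c_{b(q,s)}(r^q-r^p)$ if $s$ is even. *Sectors.* Fix a sector $\mathbf c$, i.e. a strict linear order on the $c_i$, $i\in T$. Let $H^{t+1}(\mathbf c)$ be the set of classes having a complete representative $\mathscr D$ such that all inequalities in $P(\mathscr D)$ hold for $\mathbf c$, and $H^{t+1}_k(\mathbf c)=H^{t+1}(\mathbf c)\cap H^{t+1}_k$. *Links.* The vertices of the graph $\mathscr G_{H(\mathbf c)}$ are the elements of $H^{t+1}(\mathbf c)$; the label of $v\in H_k^{t+1}$ is $i_v=k$. Elements $v',v$ are joined by an (undirected) edge with label $i\in T$ if, after possibly exchanging them, adding one block to a column $C_k$, $k\ne i_{v'}$, of a complete reduced diagram representing $v'$ gives a diagram representing $v$ with strongly extremal column $C_k$, and the entry of the added block is $i$. **Theorem.** The function $f_{\mathscr D}$ depends only on the class of $\mathscr D$; write $f_v$ for $v\in H^{t+1}$. For every $v'\in H^{t+1}(\mathbf c)$ and every $k\in\hat T$ there is $v\in H_k^{t+1}(\mathbf c)$ such that $(f_v,f_{v'})$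 satisfies condition $S$: $$f_{v'}-f_v=\sum_{i=1}^{s-1}c_{u_i}(r^{w_i}-r^{w_{i+1}})$$ for some $s\ge1$, $u_1,\dots,u_{s-1}\in T$, $w_1,\dots,w_s\in\hat T$ with $w_1=i_{v'}$, $w_s=k$ and $c_{u_1}<c_{u_2}<\dots<c_{u_{s-1}}$ in $\mathbf c$. Moreover $f_v-f_{v'}=c_i(r^{i_v}-r^{i_{v'}})$ for every edge of $\mathscr G_{H(\mathbf c)}$ joining $v,v'$ with label $i$, and $\mathscr G_{H(\mathbf c)}$ is an $S$-graph, that is: * ($P_1$) joined vertices have distinct labels; * ($P_2$) each edge has exactly one label, and distinct edges at a vertex have distinct labels; * ($P_3$) there is a map $v\mapsto g_v$ to bilinear functions $\sum_{i,j} d_{ij}c_jm^i$, $d_{ij}\in\mathbb Z$, with $g_v-g_{v'}=c_i(r^{i_v}-r^{i_{v'}})$ for each edge joining $v,v'$ with label $i$; * ($P_4$) there is exactly one family $v_{t+1},v_t,\dots,v_1$ of vertices such that $v_i$ has label $i$ and $v_{i+1},v_i$ are joined by an edge with label $i$; * ($P_5$) the graph is connected; * ($P_6$) if $a,b,c,d$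 are distinct vertices and $(a,b),(b,c),(c,d)$ are edges with labels $i,k,i$ (a triad), then $a$ and $d$ have the same label; moreover $c_i<c_k$ in $\mathbf c$ for each triad; * ($P_7$) from every vertex and for every $k\in\hat T$ there is a path, with strictly increasing edge labels with respect to $\mathbf c$, to a vertex with label $k$. -/

import Mathlib

/-!
Throughout `t` is a natural number.  Columns (the set `{1, …, t+1}`) are indexed by `Fin (t+1)`, and
coefficients (the set `{1, …, t}`) by `Fin t`, both starting from `0`: the column with number `i` in the
usual count is `i - 1` here, and likewise for coefficients.  Rows (levels) are counted from `1`.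
-/

namespace Preparation

variable {t : ℕ}

/-! ### Diagrams -/

/-- The height of a diagram given by its column heights. -/
def maxHeight (h : Fin (t + 1) → ℕ) : ℕ := Finset.univ.sup h

/-- Columns `i` and `j` are neighbours at level `s`, `i` being the left one:  both have height at least
`s` and every column strictly between them has height less than `s`. -/
def Neighbours (h : Fin (t + 1) → ℕ) (s : ℕ) (i j : Fin (t + 1)) : Prop :=
  i < j ∧ s ≤ h i ∧ s ≤ h j ∧ ∀ k, i < k → k < j → h k < s

instance (h : Fin (t + 1) → ℕ) (s : ℕ) (i j : Fin (t + 1)) : Decidable (Neighbours h s i j) := by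
  unfold Neighbours; infer_instance

/-- A left extremal column: no neighbour to the left at the level of its own height. -/
def LeftExtremal (h : Fin (t + 1) → ℕ) (i : Fin (t + 1)) : Prop := ∀ j, j < i → h j < h i

/-- A right extremal column: no neighbour to the right at the level of its own height. -/
def RightExtremal (h : Fin (t + 1) → ℕ) (i : Fin (t + 1)) : Prop := ∀ j, i < j → h j < h i

/-- A diagram of order `t + 1`: `t + 1` columns of blocks satisfying both boundary conditions. -/
@[ext]
structure Diagram (t : ℕ) where
  /-- the column heights -/
  ht : Fin (t + 1) → ℕ
  left_boundary : ∀ i, LeftExtremal ht i → Even (ht i) ∨ ht i = maxHeight ht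
  right_boundary : ∀ i, RightExtremal ht i → Odd (ht i) ∨ ht i = maxHeight ht

/-- Put `n` further blocks on top of column `i`. -/
def addBlocks (h : Fin (t + 1) → ℕ) (i : Fin (t + 1)) (n : ℕ) : Fin (t + 1) → ℕ :=
  Function.update h i (h i + n)

/-- A left even or a right odd domino (two blocks) can be adjoined to column `i`.  For `h i` even, column
`i` with the domino has to be the left neighbour, at both levels `h i + 1` and `h i + 2`, of a column `j`
of height at least `h i + 2`; for `h i` odd it has to be the right neighbour of such a column. -/
def CanAdjoinDomino (h : Fin (t + 1) → ℕ) (i : Fin (t + 1)) : Prop :=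
  (Even (h i) ∧ ∃ j, i < j ∧ h i + 2 ≤ h j ∧ ∀ k, i < k → k < j → h k < h i + 1) ∨
  (Odd (h i) ∧ ∃ j, j < i ∧ h i + 2 ≤ h j ∧ ∀ k, j < k → k < i → h k < h i + 1)

/-- A diagram is complete if no left even or right odd domino can be adjoined to it. -/
def Diagram.Complete (D : Diagram t) : Prop := ∀ i, ¬ CanAdjoinDomino D.ht i

/-- A diagram is reduced if no two adjacent non-empty rows are equal, that is, if there is a column of
every positive height less than the height of the diagram. -/
def Diagram.Reduced (D : Diagram t) : Prop :=
  ∀ s, 1 ≤ s → s < maxHeight D.ht → ∃ k, D.ht k = s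

/-- The columns of maximal height. -/
def maxColumns (h : Fin (t + 1) → ℕ) : Finset (Fin (t + 1)) :=
  Finset.univ.filter fun i => h i = maxHeight h

theorem maxColumns_nonempty (h : Fin (t + 1) → ℕ) : (maxColumns h).Nonempty := by
  obtain ⟨i, _, hi⟩ := Finset.exists_mem_eq_sup Finset.univ Finset.univ_nonempty h
  exact ⟨i, by simp [maxColumns, maxHeight, hi]⟩

/-- The strongly extremal column: the leftmost (resp. rightmost) column of maximal height if the height
of the diagram is odd (resp. even).  For the empty diagram it is the last column. -/
def strongColumn (h : Fin (t + 1) → ℕ) : Fin (t + 1) :=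
  if Odd (maxHeight h) then (maxColumns h).min' (maxColumns_nonempty h)
  else (maxColumns h).max' (maxColumns_nonempty h)

/-- The operations that generate the equivalence of diagrams: adjunction of a left even or right odd
domino, adjunction of a half-domino (one block on top of the strongly extremal column), and removal of two
equal adjacent rows (the rows `s + 1` and `s + 2`). -/
inductive Step : Diagram t → Diagram t → Prop
  | domino (D D' : Diagram t) (i : Fin (t + 1)) (hi : CanAdjoinDomino D.ht i)
      (h : D'.ht = addBlocks D.ht i 2) : Step D D'
  | halfDomino (D D' : Diagram t)
      (h : D'.ht = addBlocks D.ht (strongColumn D.ht) 1) : Step D D'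
  | removeRows (D D' : Diagram t) (s : ℕ) (hs : ∀ k, D.ht k ≠ s + 1)
      (h : D'.ht = fun k => if s + 2 ≤ D.ht k then D.ht k - 2 else D.ht k) : Step D D'

/-- The set of equivalence classes of diagrams of order `t + 1`, for the equivalence relation generated
by the operations above. -/
def H (t : ℕ) : Type := Quot (Step (t := t))

/-- The class of a diagram. -/
def H.mk (D : Diagram t) : H t := Quot.mk _ D

/-! The strongly extremal column depends only on the class. -/

theorem le_maxHeight (h : Fin (t + 1) → ℕ) (i : Fin (t + 1)) : h i ≤ maxHeight h :=
  Finset.le_sup (f := h) (Finset.mem_univ i)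

theorem maxHeight_eq {h : Fin (t + 1) → ℕ} {r : ℕ} (k : Fin (t + 1)) (hk : h k = r)
    (hr : ∀ j, h j ≤ r) : maxHeight h = r :=
  le_antisymm (Finset.sup_le fun j _ => hr j) (hk ▸ le_maxHeight h k)

theorem strongColumn_spec (h : Fin (t + 1) → ℕ) :
    h (strongColumn h) = maxHeight h ∧
    (Odd (maxHeight h) → ∀ j, j < strongColumn h → h j < maxHeight h) ∧
    (Even (maxHeight h) → ∀ j, strongColumn h < j → h j < maxHeight h) := by
  have key : ∀ j, h j = maxHeight h → j ∈ maxColumns h := fun j hj => by simp [maxColumns, hj]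
  refine ⟨?_, fun ho j hj => ?_, fun he j hj => ?_⟩
  · have : strongColumn h ∈ maxColumns h := by
      unfold strongColumn
      split_ifs
      · exact Finset.min'_mem _ _
      · exact Finset.max'_mem _ _
    simpa [maxColumns] using this
  · refine lt_of_le_of_ne (le_maxHeight h j) fun e => ?_
    rw [strongColumn, if_pos ho] at hj
    exact absurd (Finset.min'_le _ _ (key j e)) (not_le.2 hj)
  · refine lt_of_le_of_ne (le_maxHeight h j) fun e => ?_
    rw [strongColumn, if_neg (Nat.not_odd_iff_even.2 he)] at hj
    exact absurd (Finset.le_max' _ _ (key j e)) (not_le.2 hj)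

theorem strongColumn_eq {h : Fin (t + 1) → ℕ} {k : Fin (t + 1)} {r : ℕ} (hk : h k = r)
    (hr : ∀ j, h j ≤ r) (ho : Odd r → ∀ j, j < k → h j < r)
    (he : Even r → ∀ j, k < j → h j < r) : strongColumn h = k := by
  have hm := maxHeight_eq k hk hr
  obtain ⟨h1, h2, h3⟩ := strongColumn_spec h
  rw [hm] at h1 h2 h3
  rcases lt_trichotomy (strongColumn h) k with hlt | heq | hgt
  · rcases Nat.even_or_odd r with e | o
    · exact absurd (h3 e k hlt) (by omega)
    · exact absurd (ho o _ hlt) (by omega)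
  · exact heq
  · rcases Nat.even_or_odd r with e | o
    · exact absurd (he e _ hgt) (by omega)
    · exact absurd (h2 o k hgt) (by omega)

theorem strongColumn_step {D D' : Diagram t} (hs : Step D D') :
    strongColumn D.ht = strongColumn D'.ht := by
  obtain ⟨h1, h2, h3⟩ := strongColumn_spec D.ht
  have hle := le_maxHeight D.ht
  symm
  cases hs with
  | domino i hi h =>
    have hv : ∀ j, D'.ht j = if j = i then D.ht i + 2 else D.ht j := fun j => by
      rw [h, addBlocks, Function.update_apply]
    have hne : strongColumn D.ht ≠ i := by
      intro e
      rcases hi with ⟨_, j, _, hj, _⟩ | ⟨_, j, _, hj, _⟩ <;>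
      · have := hle j
        rw [e] at h1
        omega
    have hi2 : D.ht i + 2 ≤ maxHeight D.ht := by
      rcases hi with ⟨_, j, _, hj, _⟩ | ⟨_, j, _, hj, _⟩ <;>
      · have := hle j
        omega
    refine strongColumn_eq (r := maxHeight D.ht) (by rw [hv, if_neg hne, h1]) (fun j => ?_)
      (fun ho j hj => ?_) (fun he j hj => ?_)
    · rw [hv]; split_ifs
      · exact hi2
      · exact hle j
    · rw [hv]; split_ifs with hji
      · refine lt_of_le_of_ne hi2 fun e => ?_
        rcases hi with ⟨hp, l, hl, hj2, _⟩ | ⟨hp, l, hl, hj2, _⟩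
        · rw [← e] at ho
          exact absurd ho (Nat.not_odd_iff_even.2 (hp.add even_two))
        · have := h2 ho l (lt_trans hl (hji ▸ hj))
          omega
      · exact h2 ho j hj
    · rw [hv]; split_ifs with hji
      · refine lt_of_le_of_ne hi2 fun e => ?_
        rcases hi with ⟨hp, l, hl, hj2, _⟩ | ⟨hp, l, hl, hj2, _⟩
        · have := h3 he l (lt_trans (hji ▸ hj) hl)
          omega
        · rw [← e] at he
          exact absurd (hp.add_even even_two) (Nat.not_odd_iff_even.2 he)
      · exact h3 he j hj
  | halfDomino h =>
    have hv : ∀ j, D'.ht j = if j = strongColumn D.ht then maxHeight D.ht + 1 else D.ht j :=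
      fun j => by rw [h, addBlocks, Function.update_apply, h1]
    refine strongColumn_eq (r := maxHeight D.ht + 1) (by rw [hv, if_pos rfl]) (fun j => ?_)
      (fun _ j hj => ?_) (fun _ j hj => ?_)
    · have := hle j
      rw [hv]; split_ifs <;> omega
    · have := hle j
      rw [hv, if_neg hj.ne]; omega
    · have := hle j
      rw [hv, if_neg hj.ne']; omega
  | removeRows s hs h =>
    have hv : ∀ j, D'.ht j = if s + 2 ≤ D.ht j then D.ht j - 2 else D.ht j := fun j => by rw [h]
    by_cases hr : maxHeight D.ht < s + 2
    · have : D'.ht = D.ht := funext fun j => by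
        have := hle j
        rw [hv, if_neg (by omega)]
      rw [this]
    · push Not at hr
      have hpar : ∀ {n : ℕ}, 2 ≤ n → Odd (n - 2) → Odd n := fun hn ho => by
        obtain ⟨m, hm⟩ := ho; exact ⟨m + 1, by omega⟩
      have hpar' : ∀ {n : ℕ}, 2 ≤ n → Even (n - 2) → Even n := fun hn ho => by
        obtain ⟨m, hm⟩ := ho; exact ⟨m + 1, by omega⟩
      have hle' : ∀ j, D'.ht j ≤ maxHeight D.ht - 2 := fun j => by
        have := hle j
        have := hs j
        rw [hv]; split_ifs <;> omega
      have hlow : ∀ j, D.ht j < maxHeight D.ht → D'.ht j = maxHeight D.ht - 2 →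
          D.ht j = maxHeight D.ht - 2 ∧ s + 2 = maxHeight D.ht := fun j h4 h5 => by
        have := hs j
        rw [hv] at h5
        split_ifs at h5 <;> omega
      refine strongColumn_eq (r := maxHeight D.ht - 2) (by rw [hv, h1, if_pos hr]) hle'
        (fun ho j hj => ?_) (fun he j hj => ?_)
      · by_contra hcon
        have ho' := hpar (by omega) ho
        obtain ⟨h4, h5⟩ := hlow j (h2 ho' j hj) (by have := hle' j; omega)
        -- the leftmost column of that height would violate the left boundary condition
        obtain ⟨l, hl, hmin⟩ := (Finset.univ.filter fun l => D.ht l = s).exists_minimal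
          ⟨j, by simp; omega⟩
        simp only [Finset.mem_filter, Finset.mem_univ, true_and] at hl hmin
        have hlj : l ≤ j := by
          by_contra hc
          exact hc (hmin (y := j) (by omega) (le_of_lt (not_le.1 hc)))
        have hext : LeftExtremal D.ht l := fun m hm => by
          have h6 := h2 ho' m (lt_of_lt_of_le hm (le_trans hlj hj.le))
          have h7 := hs m
          have h8 : D.ht m ≠ s := fun e => absurd (hmin e hm.le) (not_le.2 hm)
          omega
        rcases D.left_boundary l hext with e | e
        · rw [hl] at e
          have : maxHeight D.ht - 2 = s := by omega
          rw [this] at ho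
          exact absurd ho (Nat.not_odd_iff_even.2 e)
        · omega
      · by_contra hcon
        have he' := hpar' (by omega) he
        obtain ⟨h4, h5⟩ := hlow j (h3 he' j hj) (by have := hle' j; omega)
        obtain ⟨l, hl, hmax⟩ := (Finset.univ.filter fun l => D.ht l = s).exists_maximal
          ⟨j, by simp; omega⟩
        simp only [Finset.mem_filter, Finset.mem_univ, true_and] at hl hmax
        have hlj : j ≤ l := by
          by_contra hc
          exact hc (hmax (y := j) (by omega) (le_of_lt (not_le.1 hc)))
        have hext : RightExtremal D.ht l := fun m hm => by
          have h6 := h3 he' m (lt_of_le_of_lt (le_trans hj.le hlj) hm)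
          have h7 := hs m
          have h8 : D.ht m ≠ s := fun e => absurd (hmax e hm.le) (not_le.2 hm)
          omega
        rcases D.right_boundary l hext with e | e
        · rw [hl] at e
          have : maxHeight D.ht - 2 = s := by omega
          rw [this] at he
          exact absurd e (Nat.not_odd_iff_even.2 he)
        · omega

/-- The index `k` with `X ∈ H_k`: the position of the strongly extremal column of any representative. -/
def H.index (X : H t) : Fin (t + 1) :=
  Quot.lift (fun D : Diagram t => strongColumn D.ht) (fun _ _ h => strongColumn_step h) X

/-! ### Tableaux -/

/-- The block of column `i` at level `j ≥ 1` is the extremal block of its row: the leftmost one if `j` is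
even, the rightmost one if `j` is odd. -/
def ExtremalBlock (h : Fin (t + 1) → ℕ) (j : ℕ) (i : Fin (t + 1)) : Prop :=
  j ≤ h i ∧ (Even j → ∀ k, k < i → h k < j) ∧ (Odd j → ∀ k, i < k → h k < j)

instance (h : Fin (t + 1) → ℕ) (j : ℕ) (i : Fin (t + 1)) : Decidable (ExtremalBlock h j i) := by
  unfold ExtremalBlock; infer_instance

/-- The nearest column of height at least `j` to the left of column `i`, if there is one. -/
def leftNeighbour (h : Fin (t + 1) → ℕ) (j : ℕ) (i : Fin (t + 1)) : Option (Fin (t + 1)) :=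
  if hS : (Finset.univ.filter fun k => k < i ∧ j ≤ h k).Nonempty then some (Finset.max' _ hS) else none

/-- The nearest column of height at least `j` to the right of column `i`, if there is one. -/
def rightNeighbour (h : Fin (t + 1) → ℕ) (j : ℕ) (i : Fin (t + 1)) : Option (Fin (t + 1)) :=
  if hS : (Finset.univ.filter fun k => i < k ∧ j ≤ h k).Nonempty then some (Finset.min' _ hS) else none

/-- The entry `b(i,j)` of the block of column `i` at level `j`; it is `none` for extremal blocks and where
there is no block.  The first row carries `i` in column `i` (for `i ≤ t`); the entry at level `j + 1` is the
entry at level `j` of the left (resp. right) neighbour at level `j` for `j` odd (resp. even).  At the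
fictitious level `0`, which all columns reach, column `i` carries `i - 1` (for `i ≥ 2`). -/
def entry (h : Fin (t + 1) → ℕ) : ℕ → Fin (t + 1) → Option (Fin t)
  | 0, i => if hi : i = 0 then none else some (i.pred hi)
  | 1, i => if hi : i = Fin.last t then none else if 1 ≤ h i then some (i.castPred hi) else none
  | j + 2, i =>
    if j + 2 ≤ h i ∧ ¬ ExtremalBlock h (j + 2) i then
      (if Odd (j + 1) then leftNeighbour h (j + 1) i else rightNeighbour h (j + 1) i).bind
        (entry h (j + 1))
    else none

/-- The inequalities `c_a < c_b` which define the partial order `P(𝒯)` of the tableau with column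
heights `h`.  Let `p < q` be neighbouring columns at level `j + 1`, where `1 ≤ j + 1 ≤ ht 𝒯`; the columns
strictly between them of height at least `j` have height exactly `j`.

If `j + 1` is even, `a` is the entry of `q` at level `j + 1`, and `b` runs over the entries at level `j` of
`p` and of the columns of height `j` strictly between `p` and `q`, without the last one of this list.

If `j + 1` is odd, `a` is the entry of `p` at level `j + 1`, and `b` runs over the entries at level `j` of
the columns of height `j` strictly between `p` and `q` and of `q`, without the first one of this list. -/
def TableauRel (h : Fin (t + 1) → ℕ) (a b : Fin t) : Prop :=
  ∃ j < maxHeight h, ∃ p q, Neighbours h (j + 1) p q ∧ ∃ x, j ≤ h x ∧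
    ((Even (j + 1) ∧ p ≤ x ∧ (∃ y, x < y ∧ y < q ∧ j ≤ h y) ∧
        entry h (j + 1) q = some a ∧ entry h j x = some b) ∨
      (Odd (j + 1) ∧ x ≤ q ∧ (∃ y, p < y ∧ y < x ∧ j ≤ h y) ∧
        entry h (j + 1) p = some a ∧ entry h j x = some b))

/-- The set `H^{t+1}(𝐜)` for the sector given by the linear order `lt` (where `lt a b` stands for
`c_a < c_b`): the classes with a complete representative whose partial order lifts to `lt`. -/
def HSector (lt : Fin t → Fin t → Prop) : Set (H t) :=
  {X | ∃ D : Diagram t, H.mk D = X ∧ D.Complete ∧ ∀ a b, TableauRel D.ht a b → lt a b}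

/-! ### Functions -/

/-- Bilinear functions `∑ d_i m^i` with `d_i ∈ ∑ ℤ c_j`, the `c_j` and `m^i` being indeterminates;
`f i j` is the coefficient of `c_j m^i`. -/
abbrev Bilin (t : ℕ) : Type := Fin (t + 1) → Fin t → ℤ

/-- The Kashiwara function `r^k = m^k + 2 ∑_{i > k} m^i`, by its coefficients.  Only differences matter,
and these are determined by `r^k - r^{k+1} = m^k + m^{k+1}`. -/
def kashiwara (k i : Fin (t + 1)) : ℤ := if i = k then 1 else if k < i then 2 else 0

/-- The function `c_a (r^p - r^q)`. -/
def cr (a : Fin t) (p q : Fin (t + 1)) : Bilin t :=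
  fun i j => if j = a then kashiwara p i - kashiwara q i else 0

/-- The driving function `h = -∑ c_i m^i`. -/
def driving : Bilin t := fun i j => if i = j.castSucc then -1 else 0

/-- The contribution of row `s ≥ 1`: the sum over neighbouring columns `p < q` at level `s` of
`c_{b(p,s)} (r^p - r^q)` for `s` odd, and of `c_{b(q,s)} (r^q - r^p)` for `s` even. -/
def rowFun (h : Fin (t + 1) → ℕ) (s : ℕ) : Bilin t :=
  ∑ p, ∑ q, if Neighbours h s p q then
    (if Odd s then (entry h s p).elim 0 (fun a => cr a p q)
      else (entry h s q).elim 0 (fun a => cr a q p)) else 0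

/-- The function `f_𝒯` of a tableau. -/
def Diagram.toFun (D : Diagram t) : Bilin t :=
  driving + ∑ s ∈ Finset.Icc 1 (maxHeight D.ht), rowFun D.ht s

/-- Condition `S` for the pair `(X, X')`, where `F` gives the functions of `X` and `X'`: the difference
`F X' - F X` is a sum of terms `c_{u_i} (r^{v_i} - r^{v_{i+1}})`, the `v_i` leading from the index of `X'` to
the index of `X`, with the `c_{u_i}` increasing in the sector. -/
def ConditionS (lt : Fin t → Fin t → Prop) (F : H t → Bilin t) (X X' : H t) : Prop :=
  ∃ (n : ℕ) (u : Fin n → Fin t) (v : Fin (n + 1) → Fin (t + 1)),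
    v 0 = X'.index ∧ v (Fin.last n) = X.index ∧ (∀ a b, a < b → lt (u a) (u b)) ∧
    F X' - F X = ∑ i, cr (u i) (v i.castSucc) (v i.succ)

/-! ### Labelled graphs -/

/-- Undirected graphs whose vertices carry labels in `{1, …, t+1}` and whose edges carry labels in
`{1, …, t}`; `Edge v w i` says that `v` and `w` are joined by an edge with label `i`. -/
structure LabelledGraph (t : ℕ) where
  /-- vertices -/
  V : Type
  /-- vertex labels -/
  label : V → Fin (t + 1)
  /-- labelled edges -/
  Edge : V → V → Fin t → Prop
  symm : ∀ v w i, Edge v w i → Edge w v i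

namespace LabelledGraph

/-- The full subgraph on a set of vertices. -/
def induce (G : LabelledGraph t) (S : Set G.V) : LabelledGraph t where
  V := S
  label v := G.label v
  Edge v w i := G.Edge v w i
  symm v w i h := G.symm v w i h

variable (G : LabelledGraph t)

/-- `(P₁)` Joined vertices have distinct labels. -/
def P1 : Prop := ∀ v w i, G.Edge v w i → G.label v ≠ G.label w

/-- `(P₂)` Every edge has exactly one label, and distinct edges at a vertex have distinct labels. -/
def P2 : Prop :=
  (∀ v w i i', G.Edge v w i → G.Edge v w i' → i = i') ∧
  (∀ v w w' i, G.Edge v w i → G.Edge v w' i → w = w')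

/-- `f_v - f_w = c_{v,w} (r^{i_v} - r^{i_w})` for all edges. -/
def IsEvaluation (f : G.V → Bilin t) : Prop :=
  ∀ v w i, G.Edge v w i → f v - f w = cr i (G.label v) (G.label w)

/-- `(P₃)` -/
def P3 : Prop := ∃ f : G.V → Bilin t, G.IsEvaluation f

/-- A pointed chain `v_{t+1}, v_t, …, v_1`. -/
def IsPointedChain (C : Fin (t + 1) → G.V) : Prop :=
  (∀ i, G.label (C i) = i) ∧ ∀ i : Fin t, G.Edge (C i.succ) (C i.castSucc) i

/-- `(P₄)` There is a unique pointed chain. -/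
def P4 : Prop := ∃! C : Fin (t + 1) → G.V, G.IsPointedChain C

/-- `(P₅)` The graph is connected. -/
def P5 : Prop :=
  Nonempty G.V ∧ ∀ v w, Relation.ReflTransGen (fun x y => ∃ i, G.Edge x y i) v w

/-- A triad: four vertices successively joined by edges, the first and the last edge having the same
label `i` (and the middle edge the label `k`). -/
def Triad (a b c d : G.V) (i k : Fin t) : Prop :=
  [a, b, c, d].Nodup ∧ G.Edge a b i ∧ G.Edge b c k ∧ G.Edge c d i

/-- `(P₆)` The graph is triadic. -/
def P6 : Prop := ∀ a b c d i k, G.Triad a b c d i k → G.label a = G.label d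

/-- The partial order defined by the triads lifts to the order `lt`. -/
def OrderLifts (lt : Fin t → Fin t → Prop) : Prop :=
  ∀ a b c d i k, G.Triad a b c d i k → lt i k

/-- There is an ordered path from `v'` to `v`: the labels of successive edges increase. -/
def OrderedPath (lt : Fin t → Fin t → Prop) (v' v : G.V) : Prop :=
  ∃ (n : ℕ) (p : Fin (n + 1) → G.V) (u : Fin n → Fin t),
    p 0 = v' ∧ p (Fin.last n) = v ∧ (∀ i, G.Edge (p i.castSucc) (p i.succ) (u i)) ∧
    ∀ a b, a < b → lt (u a) (u b)

/-- `(P₇)` The `S` condition: from every vertex there is an ordered path to a vertex of any given label. -/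
def P7 (lt : Fin t → Fin t → Prop) : Prop :=
  ∀ v' k, ∃ v, G.label v = k ∧ G.OrderedPath lt v' v

/-- An `S`-graph, with respect to the linear order `lt` lifting the partial order of its triads. -/
structure IsSGraph (lt : Fin t → Fin t → Prop) : Prop where
  p1 : G.P1
  p2 : G.P2
  p3 : G.P3
  p4 : G.P4
  p5 : G.P5
  p6 : G.P6
  order : G.OrderLifts lt
  p7 : G.P7 lt

end LabelledGraph

/-- Single block linkage from `X'` to `X`:  a single block, with entry `i`, is put on top of a column `k`
of a complete reduced representative `D'` of `X'`, where `k` is not the index of `X'`, to give a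
representative `D` of `X` with index `k`. -/
def Link (X' X : H t) (i : Fin t) : Prop :=
  ∃ (D' D : Diagram t) (k : Fin (t + 1)), H.mk D' = X' ∧ H.mk D = X ∧ D'.Complete ∧ D'.Reduced ∧
    D.ht = addBlocks D'.ht k 1 ∧ X'.index ≠ k ∧ X.index = k ∧ entry D.ht (D.ht k) k = some i

/-- The graph of links on `H^{t+1}`. -/
def linkGraph (t : ℕ) : LabelledGraph t where
  V := H t
  label := H.index
  Edge X Y i := Link X Y i ∨ Link Y X i
  symm _ _ _ h := h.symm

/-- The graph of links on `H^{t+1}(𝐜)`. -/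
def sectorGraph (lt : Fin t → Fin t → Prop) : LabelledGraph t := (linkGraph t).induce (HSector lt)

end Preparation

/-!
Every column of a diagram can be followed through the rows: laying row `s` moves the entry of each column of
height at least `s` to its neighbour, to the right for `s` odd and to the left for `s` even, and the boundary
conditions say that the extremal block, which has no entry, always passes on to the extremal block of the next
row.  So the entries come to rest as a labelling of all the columns but the strongly extremal one (`topLabel`)
by the coefficients, bijectively.  The contributions of the rows to `f` telescope, and `f` depends only on the
top labels (`Diagram.toFun_eq`).  Adjoining a domino exchanges two entries and exchanges them back, and two
equal rows move all entries back and forth, so the top labels depend only on the class (`topLabel_step`).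

In a complete diagram every column which is not of maximal height has a parent, higher by one block, and the
columns form a tree with the strongly extremal column as root.  The descendants of a column `x` are the columns
between `x` and the gap of its top label `g`, that is, the gap between the columns `g` and `g + 1`
(`IsComplete.nbr_eq_far`).  Therefore the top labels determine the tree, and so the class (`H.ext_topLabel`);
and since the inequalities of the tableau compare parents and children, a class lies in the sector if and only
if its top labels form a heap (`mem_HSector_iff`): the coefficients whose gaps lie between a column and the gap
of its label are larger than the label (`HeapLabelling`).

A link moves the root to another column and puts the label `i` of that column on the former root
(`Link.exchange`); this gives the values of `f` on edges.  In the sector such an edge exists as soon as the gaps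
strictly between the root and the gap of `i` are all larger than `i` (`exists_link`), and then the column with
label `i` is on the other side of that gap.  This rests on a pigeonhole argument,
`HeapLabelling.eq_of_separates`.  What remains is a game with the gaps.  Crossing the smallest gap between the
root and a given column leaves only larger gaps to be crossed, whence the ordered paths, and with them
condition `S`.  In a triad the root crosses the gap of `i`, that of `k` and that of `i` again, all other gaps
being crossed with an edge labelled `i` being larger than `i`; so `i` is smaller than `k`.  Putting the labels on
their own columns one after the other, the largest first, connects every vertex with the class of the empty
diagram (`connected_emptyVertex`).
-/

namespace Preparation

variable {t : ℕ}

/-! ### The direction attached to a height -/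

/-- Column `b` lies ahead of column `a` in the direction attached to the height `n`: to the right for `n`
even, to the left for `n` odd.  Left and right are exchanged in passing from `n` to `n + 1`, so that all the
statements about diagrams which come in two mirror images become a single one. -/
def Ahead (n : ℕ) (a b : Fin (t + 1)) : Prop :=
  (n % 2 = 0 ∧ a.val < b.val) ∨ (n % 2 = 1 ∧ b.val < a.val)

theorem Ahead.trans {n : ℕ} {a b c : Fin (t + 1)} (h : Ahead n a b) (h' : Ahead n b c) :
    Ahead n a c := by
  unfold Ahead at *; omega

theorem Ahead.irrefl {n : ℕ} {a : Fin (t + 1)} : ¬ Ahead n a a := by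
  unfold Ahead; omega

theorem ahead_succ {n : ℕ} {a b : Fin (t + 1)} : Ahead (n + 1) a b ↔ Ahead n b a := by
  unfold Ahead; omega

theorem ahead_congr {m n : ℕ} (h : m % 2 = n % 2) {a b : Fin (t + 1)} :
    Ahead m a b ↔ Ahead n a b := by
  unfold Ahead; omega

theorem ahead_total (n : ℕ) {a b : Fin (t + 1)} (h : a ≠ b) : Ahead n a b ∨ Ahead n b a := by
  have : a.val ≠ b.val := fun e => h (Fin.ext e)
  unfold Ahead; omega

theorem exists_last (n : ℕ) {p : Fin (t + 1) → Prop} {i : Fin (t + 1)} (hi : p i) :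
    ∃ l, p l ∧ (l = i ∨ Ahead n i l) ∧ ∀ k, Ahead n l k → ¬ p k := by
  classical
  have hne : (Finset.univ.filter p).Nonempty := ⟨i, by simp [hi]⟩
  rcases Nat.mod_two_eq_zero_or_one n with h0 | h1
  · obtain ⟨l, hl, hmax⟩ := Finset.exists_max_image _ (fun k : Fin (t + 1) => k.val) hne
    simp only [Finset.mem_filter, Finset.mem_univ, true_and] at hl hmax
    refine ⟨l, hl, ?_, fun k hk hpk => ?_⟩
    · have := hmax i hi
      by_cases e : l = i
      · exact Or.inl e
      · have : l.val ≠ i.val := fun e' => e (Fin.ext e')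
        right; unfold Ahead; omega
    · have := hmax k hpk
      unfold Ahead at hk; omega
  · obtain ⟨l, hl, hmax⟩ := Finset.exists_min_image _ (fun k : Fin (t + 1) => k.val) hne
    simp only [Finset.mem_filter, Finset.mem_univ, true_and] at hl hmax
    refine ⟨l, hl, ?_, fun k hk hpk => ?_⟩
    · have := hmax i hi
      by_cases e : l = i
      · exact Or.inl e
      · have : l.val ≠ i.val := fun e' => e (Fin.ext e')
        right; unfold Ahead; omega
    · have := hmax k hpk
      unfold Ahead at hk; omega

theorem exists_nearest (n : ℕ) {p : Fin (t + 1) → Prop} {i j : Fin (t + 1)} (hij : Ahead n i j)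
    (hj : p j) : ∃ l, Ahead n i l ∧ p l ∧ ∀ k, Ahead n i k → Ahead n k l → ¬ p k := by
  obtain ⟨l, ⟨h1, h2⟩, -, h3⟩ := exists_last (n + 1) (p := fun l => Ahead n i l ∧ p l) ⟨hij, hj⟩
  exact ⟨l, h1, h2, fun k hk hkl hp => h3 k (ahead_succ.2 hkl) ⟨hk, hp⟩⟩

/-! ### Admissible heights -/

/-- Both boundary conditions at once: a column which is not of maximal height has a higher column ahead of
it. -/
def Admissible (h : Fin (t + 1) → ℕ) : Prop :=
  ∀ i, h i < maxHeight h → ∃ k, Ahead (h i) i k ∧ h i < h k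

theorem Diagram.admissible (D : Diagram t) : Admissible D.ht := by
  intro i hi
  by_contra! hc
  obtain ⟨l, hl, hil, hlast⟩ := exists_last (D.ht i) (p := fun k => D.ht i ≤ D.ht k) (le_refl (D.ht i))
  have hli : D.ht l = D.ht i := by
    rcases hil with rfl | h
    · rfl
    · exact le_antisymm (hc l h) hl
  rcases Nat.even_or_odd (D.ht i) with he | ho
  · have hext : RightExtremal D.ht l := fun j hj => by
      have := hlast j (Or.inl ⟨Nat.even_iff.1 he, hj⟩)
      omega
    rcases D.right_boundary l hext with h | h
    · exact absurd he (Nat.not_even_iff_odd.2 (hli ▸ h))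
    · exact absurd (hli.symm.trans h) hi.ne
  · have hext : LeftExtremal D.ht l := fun j hj => by
      have := hlast j (Or.inr ⟨Nat.odd_iff.1 ho, hj⟩)
      omega
    rcases D.left_boundary l hext with h | h
    · exact absurd (hli ▸ h) (Nat.not_even_iff_odd.2 ho)
    · exact absurd (hli.symm.trans h) hi.ne

/-- The diagram with given admissible column heights. -/
def Diagram.ofAdmissible (h : Fin (t + 1) → ℕ) (hh : Admissible h) : Diagram t where
  ht := h
  left_boundary i hi := by
    by_contra! hc
    obtain ⟨k, hk, hlt⟩ := hh i (lt_of_le_of_ne (le_maxHeight h i) hc.2)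
    have ho := Nat.odd_iff.1 (Nat.not_even_iff_odd.1 hc.1)
    have := hi k (by unfold Ahead at hk; exact Fin.lt_def.2 (by omega))
    omega
  right_boundary i hi := by
    by_contra! hc
    obtain ⟨k, hk, hlt⟩ := hh i (lt_of_le_of_ne (le_maxHeight h i) hc.2)
    have he := Nat.even_iff.1 (Nat.not_odd_iff_even.1 hc.1)
    have := hi k (by unfold Ahead at hk; exact Fin.lt_def.2 (by omega))
    omega

theorem exists_maxHeight (h : Fin (t + 1) → ℕ) : ∃ i, h i = maxHeight h :=
  ⟨strongColumn h, (strongColumn_spec h).1⟩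

/-- The strongly extremal column is the last column of maximal height, in the direction of that height. -/
theorem not_ahead_strongColumn (h : Fin (t + 1) → ℕ) {k : Fin (t + 1)}
    (hk : Ahead (maxHeight h) (strongColumn h) k) : h k < maxHeight h := by
  obtain ⟨-, h2, h3⟩ := strongColumn_spec h
  rcases hk with ⟨he, hk⟩ | ⟨ho, hk⟩
  · exact h3 (Nat.even_iff.2 he) k hk
  · exact h2 (Nat.odd_iff.2 ho) k hk

theorem strongColumn_eq_of_last {h : Fin (t + 1) → ℕ} {k : Fin (t + 1)} (hk : h k = maxHeight h)
    (hl : ∀ j, Ahead (maxHeight h) k j → h j < maxHeight h) : strongColumn h = k :=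
  strongColumn_eq hk (le_maxHeight h)
    (fun ho j hj => hl j (Or.inr ⟨Nat.odd_iff.1 ho, hj⟩))
    (fun he j hj => hl j (Or.inl ⟨Nat.even_iff.1 he, hj⟩))

/-- Every column of maximal height except the strongly extremal one has the strongly extremal column ahead
of it. -/
theorem ahead_strongColumn {h : Fin (t + 1) → ℕ} {k : Fin (t + 1)} (hk : h k = maxHeight h)
    (hne : k ≠ strongColumn h) : Ahead (maxHeight h) k (strongColumn h) := by
  rcases ahead_total (maxHeight h) hne with h1 | h1
  · exact h1
  · have := not_ahead_strongColumn h h1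
    omega

/-! ### Neighbours and the entries after each row -/

/-- The nearest column of height at least `s` ahead of column `q` in the direction of `s`, if any. -/
def nbr (h : Fin (t + 1) → ℕ) (s : ℕ) (q : Fin (t + 1)) : Option (Fin (t + 1)) :=
  if Odd s then leftNeighbour h s q else rightNeighbour h s q

theorem nbr_eq_none {h : Fin (t + 1) → ℕ} {s : ℕ} {q : Fin (t + 1)} :
    nbr h s q = none ↔ ∀ k, Ahead s q k → h k < s := by
  unfold nbr leftNeighbour rightNeighbour
  split_ifs with ho hS hS
  · obtain ⟨k, hk⟩ := hS
    simp only [Finset.mem_filter, Finset.mem_univ, true_and] at hk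
    simp only [false_iff, not_forall]
    exact ⟨k, Or.inr ⟨Nat.odd_iff.1 ho, hk.1⟩, by omega⟩
  · simp only [true_iff]
    intro k hk
    by_contra hc
    refine hS ⟨k, ?_⟩
    simp only [Finset.mem_filter, Finset.mem_univ, true_and]
    have := Nat.odd_iff.1 ho
    unfold Ahead at hk
    exact ⟨Fin.lt_def.2 (by omega), by omega⟩
  · obtain ⟨k, hk⟩ := hS
    simp only [Finset.mem_filter, Finset.mem_univ, true_and] at hk
    simp only [false_iff, not_forall]
    exact ⟨k, Or.inl ⟨Nat.not_odd_iff.1 ho, hk.1⟩, by omega⟩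
  · simp only [true_iff]
    intro k hk
    by_contra hc
    refine hS ⟨k, ?_⟩
    simp only [Finset.mem_filter, Finset.mem_univ, true_and]
    have := Nat.not_odd_iff.1 ho
    unfold Ahead at hk
    exact ⟨Fin.lt_def.2 (by omega), by omega⟩

theorem nbr_spec {h : Fin (t + 1) → ℕ} {s : ℕ} {q p : Fin (t + 1)} (hp : nbr h s q = some p) :
    Ahead s q p ∧ s ≤ h p ∧ ∀ l, Ahead s q l → Ahead s l p → h l < s := by
  unfold nbr leftNeighbour rightNeighbour at hp
  split_ifs at hp with ho hS hS
  · simp only [Option.some.injEq] at hp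
    have hm := Finset.max'_mem _ hS
    have hle : ∀ k ∈ Finset.univ.filter fun k => k < q ∧ s ≤ h k, k ≤ p :=
      fun k hk => hp ▸ Finset.le_max' _ k hk
    rw [hp] at hm
    simp only [Finset.mem_filter, Finset.mem_univ, true_and] at hm hle
    have := Nat.odd_iff.1 ho
    refine ⟨Or.inr ⟨this, hm.1⟩, hm.2, fun l h1 h2 => ?_⟩
    by_contra hc
    unfold Ahead at h1 h2
    have := Fin.le_def.1 (hle l ⟨Fin.lt_def.2 (by omega), by omega⟩)
    omega
  · simp only [Option.some.injEq] at hp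
    have hm := Finset.min'_mem _ hS
    have hle : ∀ k ∈ Finset.univ.filter fun k => q < k ∧ s ≤ h k, p ≤ k :=
      fun k hk => hp ▸ Finset.min'_le _ k hk
    rw [hp] at hm
    simp only [Finset.mem_filter, Finset.mem_univ, true_and] at hm hle
    have := Nat.not_odd_iff.1 ho
    refine ⟨Or.inl ⟨this, hm.1⟩, hm.2, fun l h1 h2 => ?_⟩
    by_contra hc
    unfold Ahead at h1 h2
    have := Fin.le_def.1 (hle l ⟨Fin.lt_def.2 (by omega), by omega⟩)
    omega

theorem nbr_eq_some {h : Fin (t + 1) → ℕ} {s : ℕ} {q p : Fin (t + 1)} :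
    nbr h s q = some p ↔
      Ahead s q p ∧ s ≤ h p ∧ ∀ l, Ahead s q l → Ahead s l p → h l < s := by
  refine ⟨nbr_spec, fun ⟨h1, h2, h3⟩ => ?_⟩
  cases hn : nbr h s q with
  | none => have := nbr_eq_none.1 hn p h1; omega
  | some p' =>
    obtain ⟨h1', h2', h3'⟩ := nbr_spec hn
    by_contra hne
    rcases ahead_total s (a := p) (b := p') (fun e => hne (by rw [e])) with h | h
    · have := h3' p h1 h; omega
    · have := h3 p' h1' h; omega

/-- Two columns of height at least `s` with the same neighbour ahead coincide. -/
theorem nbr_inj {h : Fin (t + 1) → ℕ} {s : ℕ} {q q' p : Fin (t + 1)} (hq : s ≤ h q) (hq' : s ≤ h q')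
    (e : nbr h s q = some p) (e' : nbr h s q' = some p) : q = q' := by
  obtain ⟨h1, -, h3⟩ := nbr_spec e
  obtain ⟨h1', -, h3'⟩ := nbr_spec e'
  by_contra hne
  rcases ahead_total s hne with h | h
  · have := h3 q' h h1'; omega
  · have := h3' q h h1; omega

/-- The entries the columns carry once the rows `1, …, n` are laid: row `s` moves entries between
neighbours at level `s`, against the direction of `s`, and a column keeps the entry which reaches its top.
The last column starts without an entry. -/
def state (h : Fin (t + 1) → ℕ) : ℕ → Fin (t + 1) → Option (Fin t)
  | 0, i => if hi : i = Fin.last t then none else some (i.castPred hi)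
  | s + 1, q => if s + 1 ≤ h q then (nbr h (s + 1) q).bind (state h s) else state h s q

/-- The entry which finally comes to rest on top of a column. -/
def topLabel (h : Fin (t + 1) → ℕ) (q : Fin (t + 1)) : Option (Fin t) := state h (h q) q

theorem state_succ_of_le {h : Fin (t + 1) → ℕ} {s : ℕ} {q : Fin (t + 1)} (hq : s + 1 ≤ h q) :
    state h (s + 1) q = (nbr h (s + 1) q).bind (state h s) := by
  rw [state, if_pos hq]

theorem state_succ_of_lt {h : Fin (t + 1) → ℕ} {s : ℕ} {q : Fin (t + 1)} (hq : h q < s + 1) :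
    state h (s + 1) q = state h s q := by
  rw [state, if_neg (by omega)]

theorem state_eq_topLabel {h : Fin (t + 1) → ℕ} {n : ℕ} {q : Fin (t + 1)} (hn : h q ≤ n) :
    state h n q = topLabel h q := by
  induction n, hn using Nat.le_induction with
  | base => rfl
  | succ n hn ih => rw [state_succ_of_lt (by omega), ih]

theorem state_congr_of_le {h h' : Fin (t + 1) → ℕ} {m n : ℕ} (hmn : m ≤ n)
    (hm : state h m = state h' m) (hh : ∀ s, m < s → s ≤ n → ∀ k, s ≤ h k ↔ s ≤ h' k) :
    state h n = state h' n := by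
  induction n, hmn using Nat.le_induction with
  | base => exact hm
  | succ n hmn ih =>
    have ih := ih fun s h1 h2 => hh s h1 (by omega)
    have hk := hh (n + 1) (by omega) le_rfl
    have hn : nbr h (n + 1) = nbr h' (n + 1) := by
      funext q
      unfold nbr leftNeighbour rightNeighbour
      simp only [hk]
    funext q
    simp only [state, hk, hn, ih]

theorem state_congr {h h' : Fin (t + 1) → ℕ} {n : ℕ}
    (hh : ∀ s ≤ n, ∀ k, s ≤ h k ↔ s ≤ h' k) : state h n = state h' n :=
  state_congr_of_le (Nat.zero_le n) rfl fun s _ h2 => hh s h2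

/-- The last column of a row has no entry. -/
theorem state_last {h : Fin (t + 1) → ℕ} {s : ℕ} {q : Fin (t + 1)} (hq : s ≤ h q)
    (hl : ∀ k, Ahead s q k → h k < s) : state h s q = none := by
  cases s with
  | zero =>
    have : q = Fin.last t := by
      by_contra hne
      have hlt : q.val < t := Fin.val_lt_last hne
      exact absurd (hl (Fin.last t) (Or.inl ⟨rfl, by simpa using hlt⟩)) (by omega)
    simp [state, this]
  | succ s => rw [state_succ_of_le hq, nbr_eq_none.2 hl, Option.bind_none]

/-- By the boundary conditions the block without an entry passes from the last column of a row to the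
extremal block of the next row. -/
theorem Admissible.last_of_last_succ {h : Fin (t + 1) → ℕ} (hh : Admissible h) {s : ℕ}
    {q : Fin (t + 1)} (hq : s + 1 ≤ h q) (hl : ∀ k, Ahead s q k → h k < s + 1) :
    ∀ k, Ahead s q k → h k < s := by
  intro k hk
  have h1 := hl k hk
  by_contra hc
  have hks : h k = s := by omega
  obtain ⟨k', hk', h2⟩ := hh k (by have := le_maxHeight h q; omega)
  rw [hks] at hk' h2
  have := hl k' (hk.trans hk')
  omega

/-- After row `s` only the last column of the row has no entry. -/
theorem Admissible.last_of_state_eq_none {h : Fin (t + 1) → ℕ} (hh : Admissible h) {s : ℕ}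
    (hs : s ≤ maxHeight h) {q : Fin (t + 1)} (hq : state h s q = none) :
    s ≤ h q ∧ ∀ k, Ahead s q k → h k < s := by
  induction s generalizing q with
  | zero =>
    refine ⟨by omega, fun k hk => ?_⟩
    by_cases hl : q = Fin.last t
    · subst hl
      have := k.isLt
      unfold Ahead at hk
      simp only [Fin.val_last] at hk
      omega
    · simp [state, hl] at hq
  | succ s ih =>
    by_cases h1 : s + 1 ≤ h q
    · refine ⟨h1, ?_⟩
      rw [state_succ_of_le h1] at hq
      cases hn : nbr h (s + 1) q with
      | none => exact nbr_eq_none.1 hn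
      | some p =>
        rw [hn, Option.bind_some] at hq
        have := (ih (by omega) hq).2 q (ahead_succ.1 (nbr_spec hn).1)
        omega
    · rw [state_succ_of_lt (by omega)] at hq
      obtain ⟨h2, h3⟩ := ih (by omega) hq
      obtain ⟨k, hk, hlt⟩ := hh q (by omega)
      have hqs : h q = s := by omega
      rw [hqs] at hk
      have := h3 k hk
      omega

theorem state_injective {h : Fin (t + 1) → ℕ} {s : ℕ} {q q' : Fin (t + 1)} {a : Fin t}
    (hq : state h s q = some a) (hq' : state h s q' = some a) : q = q' := by
  induction s generalizing q q' a with
  | zero =>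
    simp only [state, Option.dite_none_left_eq_some, Option.some.injEq] at hq hq'
    obtain ⟨h1, h2⟩ := hq
    obtain ⟨h1', h2'⟩ := hq'
    exact Fin.castPred_inj.1 (h2.trans h2'.symm)
  | succ s ih =>
    by_cases h1 : s + 1 ≤ h q <;> by_cases h1' : s + 1 ≤ h q'
    · rw [state_succ_of_le h1, Option.bind_eq_some_iff] at hq
      rw [state_succ_of_le h1', Option.bind_eq_some_iff] at hq'
      obtain ⟨p, hp, hpa⟩ := hq
      obtain ⟨p', hp', hpa'⟩ := hq'
      obtain rfl := ih hpa hpa'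
      exact nbr_inj h1 h1' hp hp'
    · rw [state_succ_of_le h1, Option.bind_eq_some_iff] at hq
      obtain ⟨p, hp, hpa⟩ := hq
      rw [state_succ_of_lt (by omega)] at hq'
      obtain rfl := ih hpa hq'
      exact absurd (nbr_spec hp).2.1 h1'
    · rw [state_succ_of_le h1', Option.bind_eq_some_iff] at hq'
      obtain ⟨p, hp, hpa⟩ := hq'
      rw [state_succ_of_lt (by omega)] at hq
      obtain rfl := ih hpa hq
      exact absurd (nbr_spec hp).2.1 h1
    · rw [state_succ_of_lt (by omega)] at hq hq'
      exact ih hq hq'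

theorem topLabel_injective {h : Fin (t + 1) → ℕ} {q q' : Fin (t + 1)} {a : Fin t}
    (hq : topLabel h q = some a) (hq' : topLabel h q' = some a) : q = q' := by
  rw [← state_eq_topLabel (le_maxHeight h _)] at hq hq'
  exact state_injective hq hq'

theorem topLabel_strongColumn (h : Fin (t + 1) → ℕ) : topLabel h (strongColumn h) = none := by
  unfold topLabel
  refine state_last le_rfl fun k hk => ?_
  have := (strongColumn_spec h).1
  rw [this] at hk ⊢
  exact not_ahead_strongColumn h hk

theorem Admissible.topLabel_eq_none {h : Fin (t + 1) → ℕ} (hh : Admissible h) {q : Fin (t + 1)}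
    (hq : topLabel h q = none) : q = strongColumn h := by
  rw [← state_eq_topLabel (le_maxHeight h _)] at hq
  obtain ⟨h1, h2⟩ := hh.last_of_state_eq_none le_rfl hq
  exact (strongColumn_eq_of_last (le_antisymm (le_maxHeight h q) h1) h2).symm

/-- The entry of a block is the entry its column carries before the row of the block is laid. -/
theorem Admissible.entry_succ {h : Fin (t + 1) → ℕ} (hh : Admissible h) (s : ℕ) (q : Fin (t + 1)) :
    entry h (s + 1) q = if s + 1 ≤ h q then state h s q else none := by
  induction s generalizing q with
  | zero =>
    by_cases hq : q = Fin.last t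
    · simp [entry, state, hq]
    · simp [entry, state, hq]
  | succ s ih =>
    rw [entry]
    by_cases h1 : s + 2 ≤ h q
    · rw [if_pos (show s + 1 + 1 ≤ h q from h1), state_succ_of_le (by omega)]
      have hb : (nbr h (s + 1) q).bind (entry h (s + 1)) = (nbr h (s + 1) q).bind (state h s) := by
        cases hn : nbr h (s + 1) q with
        | none => rfl
        | some p => rw [Option.bind_some, Option.bind_some, ih, if_pos (nbr_spec hn).2.1]
      by_cases h2 : ExtremalBlock h (s + 2) q
      · rw [if_neg (by tauto)]
        have hl : ∀ k, Ahead (s + 1) q k → h k < s + 1 + 1 := by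
          intro k hk
          unfold Ahead at hk
          rcases Nat.even_or_odd (s + 2) with he | ho
          · have := Nat.even_iff.1 he
            exact h2.2.1 he k (Fin.lt_def.2 (by omega))
          · have := Nat.odd_iff.1 ho
            exact h2.2.2 ho k (Fin.lt_def.2 (by omega))
        rw [nbr_eq_none.2 (hh.last_of_last_succ h1 hl), Option.bind_none]
      · rw [if_pos ⟨h1, h2⟩, ← hb, nbr]
    · rw [if_neg (by tauto), if_neg (show ¬ s + 1 + 1 ≤ h q from h1)]

/-! ### Invariance of the top labels -/

theorem canAdjoinDomino_iff {h : Fin (t + 1) → ℕ} {i : Fin (t + 1)} :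
    CanAdjoinDomino h i ↔ ∃ j, Ahead (h i) i j ∧ h i + 2 ≤ h j ∧
      ∀ k, Ahead (h i) i k → Ahead (h i) k j → h k < h i + 1 := by
  unfold CanAdjoinDomino
  constructor
  · rintro (⟨he, j, hj, h2, h3⟩ | ⟨ho, j, hj, h2, h3⟩)
    · have := Nat.even_iff.1 he
      refine ⟨j, Or.inl ⟨this, hj⟩, h2, fun k h4 h5 => ?_⟩
      unfold Ahead at h4 h5
      exact h3 k (Fin.lt_def.2 (by omega)) (Fin.lt_def.2 (by omega))
    · have := Nat.odd_iff.1 ho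
      refine ⟨j, Or.inr ⟨this, hj⟩, h2, fun k h4 h5 => ?_⟩
      unfold Ahead at h4 h5
      exact h3 k (Fin.lt_def.2 (by omega)) (Fin.lt_def.2 (by omega))
  · rintro ⟨j, ⟨he, hj⟩ | ⟨ho, hj⟩, h2, h3⟩
    · exact Or.inl ⟨Nat.even_iff.2 he, j, hj, h2, fun k h4 h5 =>
        h3 k (Or.inl ⟨he, h4⟩) (Or.inl ⟨he, h5⟩)⟩
    · exact Or.inr ⟨Nat.odd_iff.2 ho, j, hj, h2, fun k h4 h5 =>
        h3 k (Or.inr ⟨ho, h5⟩) (Or.inr ⟨ho, h4⟩)⟩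

theorem addBlocks_apply (h : Fin (t + 1) → ℕ) (i : Fin (t + 1)) (n : ℕ) (k : Fin (t + 1)) :
    addBlocks h i n k = if k = i then h i + n else h k := by
  rw [addBlocks, Function.update_apply]

/-- The first row of a domino exchanges the entries of its column and of the column ahead of it; the
second row undoes the exchange. -/
theorem state_addBlocks_two {h : Fin (t + 1) → ℕ} {i : Fin (t + 1)} (hi : CanAdjoinDomino h i) :
    state (addBlocks h i 2) (h i + 2) = state h (h i + 2) := by
  obtain ⟨j, hij, hj, hbet⟩ := canAdjoinDomino_iff.1 hi
  set h' := addBlocks h i 2 with hh'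
  set s := h i with hs
  have hi' : h' i = s + 2 := by rw [hh', addBlocks_apply, if_pos rfl]
  have hne' : ∀ k, k ≠ i → h' k = h k := fun k hk => by rw [hh', addBlocks_apply, if_neg hk]
  have hle : ∀ k, h k ≤ h' k := fun k => by
    by_cases hk : k = i
    · subst hk; omega
    · rw [hne' k hk]
  have hji : j ≠ i := fun e => by rw [e] at hj; omega
  have hjs : h' j = h j := hne' j hji
  have h0 : state h' s = state h s := state_congr fun n hn k => by
    by_cases hk : k = i
    · subst hk; omega
    · rw [hne' k hk]
  -- a column of height at least `s + 1` ahead of `i` is `j` or lies ahead of `j`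
  have hbeyond : ∀ q, s + 1 ≤ h q → q ≠ j → Ahead s i q → Ahead s j q := fun q hq hqj hiq => by
    rcases ahead_total s hqj with h1 | h1
    · have := hbet q hiq h1; omega
    · exact h1
  have n1j : nbr h' (s + 1) j = some i := nbr_eq_some.2 ⟨ahead_succ.2 hij, by omega, fun l h1 h2 => by
    have h3 := hbet l (ahead_succ.1 h2) (ahead_succ.1 h1)
    rw [hne' l]
    · exact h3
    · rintro rfl; exact Ahead.irrefl h2⟩
  have n1i : nbr h' (s + 1) i = nbr h (s + 1) j := by
    cases hn : nbr h (s + 1) j with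
    | none =>
      rw [nbr_eq_none] at hn ⊢
      intro k hk
      have := hn k ((ahead_succ.2 hij).trans hk)
      rwa [hne' k]
      rintro rfl; exact Ahead.irrefl hk
    | some p =>
      rw [nbr_eq_some] at hn ⊢
      obtain ⟨h1, h2, h3⟩ := hn
      have hip : Ahead (s + 1) i p := by
        have hpi : i ≠ p := fun e => by rw [← e] at h2; omega
        rcases ahead_total (s + 1) hpi with h4 | h4
        · exact h4
        · have := hbet p (ahead_succ.1 h4) (ahead_succ.1 h1); omega
      refine ⟨hip, le_trans h2 (hle p), fun l h4 h5 => ?_⟩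
      have := h3 l ((ahead_succ.2 hij).trans h4) h5
      rwa [hne' l]
      rintro rfl; exact Ahead.irrefl h4
  have n1q : ∀ q, q ≠ i → q ≠ j → s + 1 ≤ h q → nbr h' (s + 1) q = nbr h (s + 1) q := by
    intro q hqi hqj hq
    cases hn : nbr h (s + 1) q with
    | none =>
      rw [nbr_eq_none] at hn ⊢
      intro k hk
      by_cases hki : k = i
      · subst hki
        have := hn j (ahead_succ.2 (hbeyond q hq hqj (ahead_succ.1 hk)))
        omega
      · rw [hne' k hki]; exact hn k hk
    | some p =>
      rw [nbr_eq_some] at hn ⊢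
      obtain ⟨h1, h2, h3⟩ := hn
      refine ⟨h1, le_trans h2 (hle p), fun l h4 h5 => ?_⟩
      by_cases hli : l = i
      · subst hli
        have h6 := hbeyond q hq hqj (ahead_succ.1 h4)
        have := h3 j (ahead_succ.2 h6) ((ahead_succ.2 hij).trans h5)
        omega
      · rw [hne' l hli]; exact h3 l h4 h5
  have s1j : state h' (s + 1) j = state h s i := by
    rw [state_succ_of_le (by omega), n1j, Option.bind_some, h0]
  have s1i : state h' (s + 1) i = state h (s + 1) j := by
    rw [state_succ_of_le (by omega), n1i, h0, state_succ_of_le (by omega)]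
  have s1q : ∀ q, q ≠ i → q ≠ j → state h' (s + 1) q = state h (s + 1) q := by
    intro q hqi hqj
    by_cases hq : s + 1 ≤ h q
    · rw [state_succ_of_le (by rw [hne' q hqi]; exact hq), n1q q hqi hqj hq, h0,
        state_succ_of_le hq]
    · rw [state_succ_of_lt (by rw [hne' q hqi]; omega), h0, state_succ_of_lt (by omega)]
  have ah2 : ∀ a b : Fin (t + 1), Ahead (s + 1 + 1) a b ↔ Ahead s a b :=
    fun a b => ahead_congr (by omega)
  have n2i : nbr h' (s + 1 + 1) i = some j := nbr_eq_some.2 ⟨(ah2 _ _).2 hij, by omega, fun l h1 h2 => by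
    rw [ah2] at h1 h2
    have := hbet l h1 h2
    rw [hne' l]
    · omega
    · rintro rfl; exact Ahead.irrefl h1⟩
  funext q
  by_cases hqi : q = i
  · subst hqi
    rw [state_succ_of_le (by omega), n2i, Option.bind_some, s1j, state_succ_of_lt (by omega),
      state_succ_of_lt (by omega)]
  by_cases hq : s + 1 + 1 ≤ h q
  swap
  · rw [state_succ_of_lt (h := h') (s := s + 1) (by rw [hne' q hqi]; omega),
      state_succ_of_lt (h := h) (s := s + 1) (by omega)]
    exact s1q q hqi fun e => hq (by rw [e]; omega)
  rw [state_succ_of_le (by rw [hne' q hqi]; exact hq), state_succ_of_le hq]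
  cases hn : nbr h (s + 1 + 1) q with
  | none =>
    have : nbr h' (s + 1 + 1) q = none := by
      rw [nbr_eq_none] at hn ⊢
      intro k hk
      by_cases hki : k = i
      · subst hki
        have := hn j (hk.trans ((ah2 _ _).2 hij))
        omega
      · rw [hne' k hki]; exact hn k hk
    rw [this]; rfl
  | some p =>
    obtain ⟨h1, h2, h3⟩ := nbr_spec hn
    have hpi : p ≠ i := fun e => by rw [e] at h2; omega
    by_cases hpj : p = j
    · subst hpj
      have hqi' : Ahead s q i := by
        rcases ahead_total s hqi with h4 | h4
        · exact h4
        · have := hbet q h4 ((ah2 _ _).1 h1); omega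
      have : nbr h' (s + 1 + 1) q = some i := nbr_eq_some.2 ⟨(ah2 _ _).2 hqi', by omega,
        fun l h4 h5 => by
          rw [hne' l]
          · exact h3 l h4 (h5.trans ((ah2 _ _).2 hij))
          · rintro rfl; exact Ahead.irrefl h5⟩
      rw [this, Option.bind_some, Option.bind_some, s1i]
    · have : nbr h' (s + 1 + 1) q = some p := nbr_eq_some.2 ⟨h1, le_trans h2 (hle p),
        fun l h4 h5 => by
          by_cases hli : l = i
          · subst hli
            have h6 := hbeyond p (by omega) hpj ((ah2 _ _).1 h5)
            have := h3 j (h4.trans ((ah2 _ _).2 hij)) ((ah2 _ _).2 h6)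
            omega
          · rw [hne' l hli]; exact h3 l h4 h5⟩
      rw [this, Option.bind_some, Option.bind_some, s1q p hpi hpj]

theorem topLabel_addBlocks_two {h : Fin (t + 1) → ℕ} {i : Fin (t + 1)} (hi : CanAdjoinDomino h i) :
    topLabel (addBlocks h i 2) = topLabel h := by
  funext q
  set N := max (h i + 2) (max (h q) (addBlocks h i 2 q))
  rw [← state_eq_topLabel (n := N) (by omega), ← state_eq_topLabel (n := N) (by omega)]
  refine congrFun (state_congr_of_le (m := h i + 2) (by omega) (state_addBlocks_two hi)
    fun n hn _ k => ?_) q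
  rw [addBlocks_apply]
  split_ifs with hk
  · subst hk; omega
  · rfl

theorem maxHeight_addBlocks_strongColumn (h : Fin (t + 1) → ℕ) :
    maxHeight (addBlocks h (strongColumn h) 1) = maxHeight h + 1 := by
  refine maxHeight_eq (strongColumn h) ?_ fun j => ?_
  · rw [addBlocks_apply, if_pos rfl, (strongColumn_spec h).1]
  · have := le_maxHeight h j
    rw [addBlocks_apply, (strongColumn_spec h).1]
    split_ifs <;> omega

theorem topLabel_addBlocks_strongColumn (h : Fin (t + 1) → ℕ) :
    topLabel (addBlocks h (strongColumn h) 1) = topLabel h := by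
  have hr := (strongColumn_spec h).1
  have hle := le_maxHeight h
  have h0 : state (addBlocks h (strongColumn h) 1) (maxHeight h) = state h (maxHeight h) :=
    state_congr fun n hn k => by
      rw [addBlocks_apply]
      split_ifs with hk
      · subst hk; omega
      · rfl
  have hr' : addBlocks h (strongColumn h) 1 (strongColumn h) = maxHeight h + 1 := by
    rw [addBlocks_apply, if_pos rfl, hr]
  funext q
  by_cases hq : q = strongColumn h
  · subst hq
    rw [topLabel_strongColumn, topLabel, hr']
    refine state_last hr'.ge fun k hk => ?_
    rw [addBlocks_apply, if_neg, Nat.lt_succ_iff]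
    · exact hle k
    · rintro rfl; exact Ahead.irrefl hk
  · rw [← state_eq_topLabel (n := maxHeight h) (hle q), ← h0, state_eq_topLabel]
    rw [addBlocks_apply, if_neg hq]
    exact hle q

/-- Two equal adjacent rows move the entries back and forth. -/
theorem Admissible.state_add_two {h : Fin (t + 1) → ℕ} (hh : Admissible h) {s : ℕ}
    (hs : ∀ k, h k ≠ s + 1) : state h (s + 2) = state h s := by
  have heq : ∀ k, h k < s + 1 ↔ h k < s + 1 + 1 := fun k => by have := hs k; omega
  funext q
  by_cases hq : s + 2 ≤ h q
  · rw [state_succ_of_le hq]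
    cases hn : nbr h (s + 1 + 1) q with
    | none =>
      have hl := hh.last_of_last_succ (s := s) (q := q) (by omega) fun k hk =>
        (heq k).2 (nbr_eq_none.1 hn k ((ahead_congr (by omega)).2 hk))
      rw [state_last (by omega) hl]; rfl
    | some p =>
      obtain ⟨h1, h2, h3⟩ := nbr_spec hn
      have : nbr h (s + 1) p = some q := nbr_eq_some.2 ⟨ahead_succ.1 h1, by omega,
        fun l h4 h5 => (heq l).2 (h3 l (ahead_succ.2 h5) (ahead_succ.2 h4))⟩
      rw [Option.bind_some, state_succ_of_le (by omega), this, Option.bind_some]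
  · have := hs q
    rw [state_succ_of_lt (by omega), state_succ_of_lt (by omega)]

theorem nbr_add_two {h h' : Fin (t + 1) → ℕ} {n : ℕ} (hh : ∀ k, n + 2 ≤ h k ↔ n ≤ h' k)
    (q : Fin (t + 1)) : nbr h (n + 2) q = nbr h' n q := by
  have ho : Odd (n + 2) ↔ Odd n := by simp [Nat.odd_add]
  unfold nbr leftNeighbour rightNeighbour
  simp only [hh, ho]

theorem Admissible.topLabel_removeRows {h : Fin (t + 1) → ℕ} (hh : Admissible h) {s : ℕ}
    (hs : ∀ k, h k ≠ s + 1) :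
    topLabel (fun k => if s + 2 ≤ h k then h k - 2 else h k) = topLabel h := by
  set h' : Fin (t + 1) → ℕ := fun k => if s + 2 ≤ h k then h k - 2 else h k with hh'
  have hv : ∀ k, h' k = if s + 2 ≤ h k then h k - 2 else h k := fun k => rfl
  have hlow : ∀ n ≤ s, state h' n = state h n := fun n hn => state_congr fun m hm k => by
    have := hs k
    rw [hv]; split_ifs <;> omega
  have hhigh : ∀ n, s ≤ n → state h' n = state h (n + 2) := by
    intro n hn
    induction n, hn using Nat.le_induction with
    | base => rw [hlow s le_rfl, hh.state_add_two hs]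
    | succ n hn ih =>
      have hk : ∀ k, n + 1 + 2 ≤ h k ↔ n + 1 ≤ h' k := fun k => by
        have := hs k
        rw [hv]; split_ifs <;> omega
      funext q
      by_cases hq : n + 1 ≤ h' q
      · rw [state_succ_of_le hq, ← nbr_add_two hk, ih]
        exact (state_succ_of_le ((hk q).2 hq)).symm
      · rw [state_succ_of_lt (by omega), ih]
        exact (state_succ_of_lt (by have := hk q; omega)).symm
  funext q
  by_cases hq : s + 2 ≤ h q
  · rw [topLabel, topLabel, hhigh _ (by rw [hv, if_pos hq]; omega), hv, if_pos hq,
      Nat.sub_add_cancel (by omega)]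
  · have := hs q
    rw [topLabel, topLabel, hv, if_neg hq, hlow _ (by omega)]

theorem topLabel_step {D D' : Diagram t} (hs : Step D D') : topLabel D.ht = topLabel D'.ht := by
  cases hs with
  | domino i hi h => rw [h, topLabel_addBlocks_two hi]
  | halfDomino h => rw [h, topLabel_addBlocks_strongColumn]
  | removeRows s hs h => rw [h, D.admissible.topLabel_removeRows hs]

/-- The top labels of any representative. -/
def H.topLabel (X : H t) : Fin (t + 1) → Option (Fin t) :=
  Quot.lift (fun D : Diagram t => Preparation.topLabel D.ht) (fun _ _ h => topLabel_step h) X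

theorem H.exists_mk (X : H t) : ∃ D : Diagram t, H.mk D = X := Quot.exists_rep X

/-! ### The function of a class -/

/-- The function `c_a r^p`, understood as `0` if there is no entry `a`. -/
def entryFun (o : Option (Fin t)) (p : Fin (t + 1)) : Bilin t :=
  o.elim 0 fun a i j => if j = a then kashiwara p i else 0

theorem cr_eq (a : Fin t) (p q : Fin (t + 1)) :
    cr a p q = entryFun (some a) p - entryFun (some a) q := by
  funext i j
  simp only [cr, entryFun, Option.elim_some, Pi.sub_apply]
  split_ifs <;> simp

/-- The function `∑ c_{a(p)} r^p`, where `a(p)` is the entry, if any, of column `p`. -/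
def labelFun (a : Fin (t + 1) → Option (Fin t)) : Bilin t := ∑ p, entryFun (a p) p

theorem neighbours_iff {h : Fin (t + 1) → ℕ} {s : ℕ} {p q : Fin (t + 1)} :
    Neighbours h s p q ↔ if Odd s then s ≤ h q ∧ nbr h s q = some p
      else s ≤ h p ∧ nbr h s p = some q := by
  unfold Neighbours
  split_ifs with ho
  · have := Nat.odd_iff.1 ho
    rw [nbr_eq_some]
    constructor
    · rintro ⟨h1, h2, h3, h4⟩
      refine ⟨h3, Or.inr ⟨this, h1⟩, h2, fun l h5 h6 => ?_⟩
      unfold Ahead at h5 h6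
      exact h4 l (Fin.lt_def.2 (by omega)) (Fin.lt_def.2 (by omega))
    · rintro ⟨h1, h2, h3, h4⟩
      refine ⟨?_, h3, h1, fun l h5 h6 => h4 l (Or.inr ⟨this, h6⟩) (Or.inr ⟨this, h5⟩)⟩
      unfold Ahead at h2
      exact Fin.lt_def.2 (by omega)
  · have := Nat.not_odd_iff.1 ho
    rw [nbr_eq_some]
    constructor
    · rintro ⟨h1, h2, h3, h4⟩
      refine ⟨h2, Or.inl ⟨this, h1⟩, h3, fun l h5 h6 => ?_⟩
      unfold Ahead at h5 h6
      exact h4 l (Fin.lt_def.2 (by omega)) (Fin.lt_def.2 (by omega))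
    · rintro ⟨h1, h2, h3, h4⟩
      refine ⟨?_, h1, h3, fun l h5 h6 => h4 l (Or.inl ⟨this, h5⟩) (Or.inl ⟨this, h6⟩)⟩
      unfold Ahead at h2
      exact Fin.lt_def.2 (by omega)

theorem Admissible.rowFun_succ_eq_sum {h : Fin (t + 1) → ℕ} (hh : Admissible h) (s : ℕ) :
    rowFun h (s + 1) = ∑ q, ∑ p, if s + 1 ≤ h q ∧ nbr h (s + 1) q = some p then
      entryFun (state h s p) p - entryFun (state h s p) q else 0 := by
  have hterm : ∀ p q, s + 1 ≤ h p → (entry h (s + 1) p).elim 0 (fun a => cr a p q) =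
      entryFun (state h s p) p - entryFun (state h s p) q := by
    intro p q hp
    rw [hh.entry_succ, if_pos hp]
    cases state h s p with
    | none => simp [entryFun]
    | some a => rw [Option.elim_some, cr_eq]
  unfold rowFun
  simp only [neighbours_iff]
  by_cases ho : Odd (s + 1)
  · simp only [if_pos ho]
    rw [Finset.sum_comm]
    refine Finset.sum_congr rfl fun q _ => Finset.sum_congr rfl fun p _ => ?_
    split_ifs with hc
    · exact hterm p q (nbr_spec hc.2).2.1
    · rfl
  · simp only [if_neg ho]
    refine Finset.sum_congr rfl fun q _ => Finset.sum_congr rfl fun p _ => ?_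
    split_ifs with hc
    · exact hterm p q (nbr_spec hc.2).2.1
    · rfl

/-- The contributions of the rows telescope: row `s + 1` contributes the change in
`∑ c_{a(p)} r^p` which results from its moving the entries `a(p)`. -/
theorem Admissible.rowFun_succ {h : Fin (t + 1) → ℕ} (hh : Admissible h) (s : ℕ) :
    rowFun h (s + 1) = labelFun (state h s) - labelFun (state h (s + 1)) := by
  have h1 : ∀ p, (∑ q, if s + 1 ≤ h q ∧ nbr h (s + 1) q = some p then
      entryFun (state h s p) p else 0) = if s + 1 ≤ h p then entryFun (state h s p) p else 0 := by
    intro p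
    by_cases hex : ∃ q, s + 1 ≤ h q ∧ nbr h (s + 1) q = some p
    · obtain ⟨q, hq⟩ := hex
      rw [Finset.sum_eq_single q, if_pos hq, if_pos (nbr_spec hq.2).2.1]
      · exact fun q' _ hne => if_neg fun hq' => hne (nbr_inj hq'.1 hq.1 hq'.2 hq.2)
      · simp
    · rw [Finset.sum_eq_zero fun q _ => if_neg fun hq => hex ⟨q, hq⟩]
      split_ifs with hp
      · rw [state_last (by omega), entryFun, Option.elim_none]
        refine hh.last_of_last_succ hp fun k hk => ?_
        by_contra hc
        obtain ⟨q, h2, h3, h4⟩ := exists_nearest s (p := fun k => s + 1 ≤ h k) hk (by omega)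
        refine hex ⟨q, h3, nbr_eq_some.2 ⟨ahead_succ.2 h2, hp, fun l h5 h6 => ?_⟩⟩
        have := h4 l (ahead_succ.1 h6) (ahead_succ.1 h5)
        omega
      · rfl
  have h2 : ∀ q, (∑ p, if s + 1 ≤ h q ∧ nbr h (s + 1) q = some p then
      entryFun (state h s p) q else 0) =
      if s + 1 ≤ h q then entryFun (state h (s + 1) q) q else 0 := by
    intro q
    split_ifs with hq
    · rw [state_succ_of_le hq]
      cases nbr h (s + 1) q with
      | none => simp [entryFun]
      | some p => simp [hq]
    · simp [hq]
  rw [hh.rowFun_succ_eq_sum]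
  have h3 : ∀ q p, (if s + 1 ≤ h q ∧ nbr h (s + 1) q = some p then
      entryFun (state h s p) p - entryFun (state h s p) q else 0) =
      (if s + 1 ≤ h q ∧ nbr h (s + 1) q = some p then entryFun (state h s p) p else 0) -
      (if s + 1 ≤ h q ∧ nbr h (s + 1) q = some p then entryFun (state h s p) q else 0) :=
    fun q p => by split_ifs <;> simp
  simp only [h3, Finset.sum_sub_distrib, h2]
  rw [Finset.sum_comm]
  simp only [h1, labelFun]
  rw [← Finset.sum_sub_distrib, ← Finset.sum_sub_distrib]
  refine Finset.sum_congr rfl fun p _ => ?_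
  split_ifs with hp
  · rfl
  · rw [state_succ_of_lt (by omega)]; simp

theorem Diagram.toFun_eq (D : Diagram t) :
    D.toFun = driving + (labelFun (state D.ht 0) - labelFun (topLabel D.ht)) := by
  have h1 : ∀ n, ∑ s ∈ Finset.Icc 1 n, rowFun D.ht s =
      labelFun (state D.ht 0) - labelFun (state D.ht n) := by
    intro n
    induction n with
    | zero => simp
    | succ n ih =>
      rw [Finset.sum_Icc_succ_top (by omega), ih, D.admissible.rowFun_succ]
      abel
  have h2 : state D.ht (maxHeight D.ht) = topLabel D.ht :=
    funext fun q => state_eq_topLabel (le_maxHeight _ q)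
  rw [Diagram.toFun, h1, h2]

/-- The function `f_v` of a class `v`; it is determined by the top labels. -/
def H.toFun (X : H t) : Bilin t :=
  driving + (labelFun (state (fun _ => 0) 0) - labelFun X.topLabel)

theorem H.toFun_mk (D : Diagram t) : (H.mk D).toFun = D.toFun := D.toFun_eq.symm

/-! ### Complete diagrams -/

/-- Column `q` is the parent of column `y`: the nearest higher column ahead of `y`, provided that it is
higher by exactly one block. -/
def IsParent (h : Fin (t + 1) → ℕ) (y q : Fin (t + 1)) : Prop :=
  Ahead (h y) y q ∧ h q = h y + 1 ∧ ∀ k, Ahead (h y) y k → Ahead (h y) k q → h k ≤ h y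

/-- Every column which is not of maximal height has a parent.  These are the heights of the complete
diagrams; the boundary conditions are included. -/
def IsComplete (h : Fin (t + 1) → ℕ) : Prop := ∀ y, h y < maxHeight h → ∃ q, IsParent h y q

theorem IsComplete.admissible {h : Fin (t + 1) → ℕ} (hc : IsComplete h) : Admissible h :=
  fun i hi => by
    obtain ⟨q, h1, h2, -⟩ := hc i hi
    exact ⟨q, h1, by omega⟩

theorem Diagram.complete_iff (D : Diagram t) : D.Complete ↔ IsComplete D.ht := by
  constructor
  · intro hD y hy
    obtain ⟨k, hk, hlt⟩ := D.admissible y hy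
    obtain ⟨q, h1, h2, h3⟩ := exists_nearest (D.ht y) (p := fun k => D.ht y < D.ht k) hk hlt
    refine ⟨q, h1, ?_, fun k hk hkq => not_lt.1 (h3 k hk hkq)⟩
    by_contra hne
    exact hD y (canAdjoinDomino_iff.2 ⟨q, h1, by omega, fun k hk hkq => by
      have := h3 k hk hkq
      omega⟩)
  · intro hc y hy
    obtain ⟨j, h1, h2, h3⟩ := canAdjoinDomino_iff.1 hy
    obtain ⟨q, h4, h5, h6⟩ := hc y (by have := le_maxHeight D.ht j; omega)
    by_cases hjq : j = q
    · subst hjq; omega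
    rcases ahead_total (D.ht y) hjq with h | h
    · have := h6 j h1 h; omega
    · have := h3 q h4 h; omega

theorem IsParent.eq_of_nearest {h : Fin (t + 1) → ℕ} {y q p : Fin (t + 1)} (hq : IsParent h y q)
    (h1 : Ahead (h y) y p) (h2 : h y < h p)
    (h3 : ∀ k, Ahead (h y) y k → Ahead (h y) k p → h k ≤ h y) : q = p := by
  obtain ⟨h4, h5, h6⟩ := hq
  by_contra hne
  rcases ahead_total (h y) hne with h | h
  · have := h3 q h4 h; omega
  · have := h6 p h1 h; omega

/-- The column adjoining the gap of the coefficient `g` on the far side in the direction of `s`. -/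
def far (s : ℕ) (g : Fin t) : Fin (t + 1) := if s % 2 = 0 then g.succ else g.castSucc

theorem far_val (s : ℕ) (g : Fin t) : (far s g).val = if s % 2 = 0 then g.val + 1 else g.val := by
  unfold far; split_ifs <;> rfl

/-- In a complete diagram the entry which column `x` carries after row `s` tells where the next column
reached by that row is: it is the column just behind the gap of the entry. -/
theorem IsComplete.nbr_eq_far {h : Fin (t + 1) → ℕ} (hc : IsComplete h) {s : ℕ} {x : Fin (t + 1)}
    {g : Fin t} (hg : state h s x = some g) (hx : s ≤ h x) : nbr h s x = some (far s g) := by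
  induction s generalizing x with
  | zero =>
    simp only [state, Option.dite_none_left_eq_some, Option.some.injEq] at hg
    obtain ⟨hl, rfl⟩ := hg
    refine nbr_eq_some.2 ⟨Or.inl ⟨rfl, ?_⟩, by omega, fun l h1 h2 => ?_⟩
    · rw [far_val]; simp
    · unfold Ahead at h1 h2
      rw [far_val] at h2
      simp only [Nat.zero_mod, if_true, Fin.coe_castPred] at h2
      omega
  | succ s ih =>
    rw [state_succ_of_le hx, Option.bind_eq_some_iff] at hg
    obtain ⟨p, hp, hpg⟩ := hg
    have hps := (nbr_spec hp).2.1
    obtain ⟨h1, h2, h3⟩ := nbr_spec (ih hpg (by omega))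
    rw [hp, Option.some.injEq]
    by_contra hne
    set q := far s g
    have hpn : Ahead s p (far (s + 1) g) := by
      have hv : p.val ≠ (far (s + 1) g).val := fun e => hne (Fin.ext e)
      have hqv := far_val s g
      unfold Ahead at h1 ⊢
      rw [far_val] at hv ⊢
      split_ifs at hqv hv ⊢ <;> omega
    have hnq : Ahead s (far (s + 1) g) q := by
      have hqv := far_val s g
      unfold Ahead
      rw [far_val]
      split_ifs at hqv ⊢ <;> omega
    -- the highest column strictly between would have neither `p` nor `q` as its parent
    classical
    obtain ⟨y, hy, hmax⟩ := Finset.exists_max_image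
      (Finset.univ.filter fun k => Ahead s p k ∧ Ahead s k q) h
      ⟨far (s + 1) g, by simp [hpn, hnq]⟩
    simp only [Finset.mem_filter, Finset.mem_univ, true_and] at hy hmax
    have hys := h3 y hy.1 hy.2
    have hpm := le_maxHeight h p
    obtain ⟨z, hz1, hz2, hz3⟩ := hc y (by omega)
    rcases Nat.mod_two_eq_zero_or_one (h y + s) with hpar | hpar
    · have hdir : ∀ {a b : Fin (t + 1)}, Ahead (h y) a b ↔ Ahead s a b := ahead_congr (by omega)
      rw [hdir] at hz1
      by_cases hzq : z = q
      · rw [hzq] at hz2; omega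
      rcases ahead_total s hzq with h4 | h4
      · have := hmax z ⟨hy.1.trans hz1, h4⟩; omega
      · have := hz3 q (hdir.2 hy.2) (hdir.2 h4); omega
    · have hdir : ∀ {a b : Fin (t + 1)}, Ahead (h y) a b ↔ Ahead s b a := fun {a b} => by
        rw [← ahead_succ]; exact ahead_congr (by omega)
      rw [hdir] at hz1
      by_cases hzp : z = p
      · rw [hzp] at hz2; omega
      rcases ahead_total s hzp with h4 | h4
      · have := hz3 p (hdir.2 hy.1) (hdir.2 h4); omega
      · have := hmax z ⟨h4, hz1.trans hy.2⟩; omega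

/-- Column `y` lies between column `x` (exclusive) and the gap of the coefficient `g`. -/
def Between (x : Fin (t + 1)) (g : Fin t) (y : Fin (t + 1)) : Prop :=
  (x.val < y.val ∧ y.val ≤ g.val) ∨ (g.val < y.val ∧ y.val < x.val)

/-- The gap of the coefficient `j` lies strictly between column `x` and the gap of the coefficient `g`. -/
def GapBetween (x : Fin (t + 1)) (g j : Fin t) : Prop :=
  (x.val ≤ j.val ∧ j.val < g.val) ∨ (g.val < j.val ∧ j.val < x.val)

/-- In a complete diagram, all the columns between a column and the gap of its top label are lower, the
column behind that gap is not. -/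
theorem IsComplete.topLabel_spec {h : Fin (t + 1) → ℕ} (hc : IsComplete h) {x : Fin (t + 1)}
    {g : Fin t} (hg : topLabel h x = some g) :
    (∀ k, Between x g k → h k < h x) ∧ h x ≤ h (far (h x) g) ∧
      (h x % 2 = 0 ∧ x.val ≤ g.val ∨ h x % 2 = 1 ∧ g.val < x.val) := by
  obtain ⟨h1, h2, h3⟩ := nbr_spec (hc.nbr_eq_far hg le_rfl)
  have hv := far_val (h x) g
  have hpar : h x % 2 = 0 ∧ x.val ≤ g.val ∨ h x % 2 = 1 ∧ g.val < x.val := by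
    unfold Ahead at h1
    split_ifs at hv <;> omega
  refine ⟨fun k hk => h3 k ?_ ?_, h2, hpar⟩
  · unfold Ahead; unfold Between at hk; omega
  · unfold Ahead; unfold Between at hk
    split_ifs at hv <;> omega

theorem Admissible.exists_topLabel {h : Fin (t + 1) → ℕ} (hh : Admissible h) (a : Fin t) :
    ∃ x, topLabel h x = some a := by
  have hinj : Function.Injective (topLabel h) := by
    intro x y hxy
    cases hx : topLabel h x with
    | none => exact (hh.topLabel_eq_none hx).trans (hh.topLabel_eq_none (hxy.symm.trans hx)).symm
    | some b => exact topLabel_injective hx (hxy ▸ hx)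
  exact ((Fintype.bijective_iff_injective_and_card (topLabel h)).2 ⟨hinj, by simp⟩).2 (some a)

/-! ### The partial order of a complete diagram -/

theorem tableauRel_iff {h : Fin (t + 1) → ℕ} {a b : Fin t} : TableauRel h a b ↔
    ∃ j < maxHeight h, ∃ p q, j + 1 ≤ h q ∧ nbr h (j + 1) q = some p ∧ ∃ x, j ≤ h x ∧
      (x = q ∨ Ahead j x q) ∧ (∃ y, Ahead j p y ∧ Ahead j y x ∧ j ≤ h y) ∧
      entry h (j + 1) p = some a ∧ entry h j x = some b := by
  unfold TableauRel
  refine exists_congr fun j => and_congr_right fun _ => ?_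
  have hle : ∀ x p : Fin (t + 1), (x = p ∨ p < x) ↔ p ≤ x := fun x p => by
    rw [Fin.ext_iff, Fin.le_def, Fin.lt_def]; omega
  have hle' : ∀ x p : Fin (t + 1), (x = p ∨ x < p) ↔ x ≤ p := fun x p => by
    rw [Fin.ext_iff, Fin.le_def, Fin.lt_def]; omega
  have hlt : ∀ x p : Fin (t + 1), j % 2 = 1 → (Ahead j x p ↔ p < x) := fun x p hj => by
    unfold Ahead; rw [Fin.lt_def]; omega
  have hlt' : ∀ x p : Fin (t + 1), j % 2 = 0 → (Ahead j x p ↔ x < p) := fun x p hj => by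
    unfold Ahead; rw [Fin.lt_def]; omega
  rcases Nat.even_or_odd (j + 1) with he | ho
  · have hj : j % 2 = 1 := by have := Nat.even_iff.1 he; omega
    have hno : ¬ Odd (j + 1) := Nat.not_odd_iff_even.2 he
    simp only [neighbours_iff, hlt _ _ hj, he, hno, true_and, false_and,
      or_false]
    constructor
    · rintro ⟨p, q, ⟨h1, h2⟩, x, h3, h4, ⟨y, h5, h6, h7⟩, h8, h9⟩
      exact ⟨q, p, h1, h2, x, h3, (hle x p).2 h4, ⟨y, h6, h5, h7⟩, h8, h9⟩
    · rintro ⟨q, p, h1, h2, x, h3, h4, ⟨y, h6, h5, h7⟩, h8, h9⟩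
      exact ⟨p, q, ⟨h1, h2⟩, x, h3, (hle x p).1 h4, ⟨y, h5, h6, h7⟩, h8, h9⟩
  · have hj : j % 2 = 0 := by have := Nat.odd_iff.1 ho; omega
    have hne : ¬ Even (j + 1) := Nat.not_even_iff_odd.2 ho
    simp only [neighbours_iff, hlt' _ _ hj, ho, hne, true_and, false_and,
      false_or]
    constructor
    · rintro ⟨p, q, ⟨h1, h2⟩, x, h3, h4, ⟨y, h5, h6, h7⟩, h8, h9⟩
      exact ⟨p, q, h1, h2, x, h3, (hle' x q).2 h4, ⟨y, h5, h6, h7⟩, h8, h9⟩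
    · rintro ⟨p, q, h1, h2, x, h3, h4, ⟨y, h5, h6, h7⟩, h8, h9⟩
      exact ⟨p, q, ⟨h1, h2⟩, x, h3, (hle' x q).1 h4, ⟨y, h5, h6, h7⟩, h8, h9⟩

/-- The entry of the block which a column passes on in row `j`.  The entries at the fictitious level `0` are
such that this holds for `j = 0` as well. -/
theorem Admissible.entry_of_nbr {h : Fin (t + 1) → ℕ} (hh : Admissible h) {j : ℕ}
    {l x : Fin (t + 1)} (hx : nbr h j l = some x) (hl : j ≤ h l) : entry h j x = state h j l := by
  cases j with
  | zero =>
    obtain ⟨h1, -, h3⟩ := nbr_spec hx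
    have hlt : l.val < x.val := by unfold Ahead at h1; omega
    have hxl : x.val = l.val + 1 := by
      by_contra hne
      have := h3 ⟨l.val + 1, by omega⟩ (Or.inl ⟨rfl, by simp⟩) (Or.inl ⟨rfl, by simp only; omega⟩)
      omega
    have hx0 : x ≠ 0 := fun e => by rw [e] at hxl; simp at hxl
    have hll : l ≠ Fin.last t := fun e => by rw [e, Fin.val_last] at hxl; omega
    rw [entry, state, dif_neg hx0, dif_neg hll, Option.some.injEq, Fin.ext_iff]
    simp [hxl]
  | succ j =>
    rw [hh.entry_succ, if_pos (nbr_spec hx).2.1, state_succ_of_le hl, hx, Option.bind_some]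

/-- In a complete diagram, the partial order of the tableau requires exactly that the top label of the
parent be smaller than that of the child. -/
theorem IsComplete.tableauRel_iff {h : Fin (t + 1) → ℕ} (hc : IsComplete h) {a b : Fin t} :
    TableauRel h a b ↔
      ∃ y q, IsParent h y q ∧ topLabel h q = some a ∧ topLabel h y = some b := by
  have hh := hc.admissible
  rw [Preparation.tableauRel_iff]
  constructor
  · rintro ⟨j, hj, p, q, hq, hpq, x, hx, hxq, ⟨y₀, hy1, hy2, hy3⟩, ha, hb⟩
    obtain ⟨hp1, hp2, hp3⟩ := nbr_spec hpq
    obtain ⟨y, h1, h2, h3⟩ := exists_nearest (j + 1) (p := fun k => j ≤ h k)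
      (ahead_succ.2 hy2) hy3
    rw [ahead_succ] at h1
    have hyq : Ahead j y q := by
      rcases hxq with rfl | h4
      · exact h1
      · exact h1.trans h4
    have hpy : Ahead j p y := by
      by_cases e : y = y₀
      · rw [e]; exact hy1
      rcases ahead_total j e with h4 | h4
      · exact absurd hy3 (h3 y₀ (ahead_succ.2 hy2) (ahead_succ.2 h4))
      · exact hy1.trans h4
    have hyj : h y = j := by
      have := hp3 y (ahead_succ.2 hyq) (ahead_succ.2 hpy)
      omega
    have hnb : nbr h j y = some x := nbr_eq_some.2 ⟨h1, hx, fun l h4 h5 => not_le.1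
      (h3 l (ahead_succ.2 h5) (ahead_succ.2 h4))⟩
    obtain ⟨q', hq'⟩ := hc y (by omega)
    have hqq := hq'.eq_of_nearest (p := q) (by rwa [hyj]) (by omega) fun k h4 h5 => by
      rw [hyj] at h4 h5
      have := hp3 k (ahead_succ.2 h5) (ahead_succ.2 (hpy.trans h4))
      omega
    subst hqq
    have hqj : h q' = j + 1 := by rw [hq'.2.1, hyj]
    refine ⟨y, q', hq', ?_, ?_⟩
    · rw [topLabel, hqj, state_succ_of_le hq, hpq, Option.bind_some, ← ha, hh.entry_succ, if_pos hp2]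
    · rw [topLabel, hyj, ← hb, hh.entry_of_nbr hnb h2]
  · rintro ⟨y, q, hq, ha, hb⟩
    obtain ⟨h1, h2, h3⟩ := hq
    have hqm := le_maxHeight h q
    rw [topLabel, h2, state_succ_of_le h2.ge, Option.bind_eq_some_iff] at ha
    obtain ⟨p, hp, hpa⟩ := ha
    obtain ⟨hp1, hp2, hp3⟩ := nbr_spec hp
    have hx := hc.nbr_eq_far hb le_rfl
    obtain ⟨hx1, hx2, hx3⟩ := nbr_spec hx
    refine ⟨h y, by omega, p, q, h2.ge, hp, far (h y) b, hx2, ?_, ⟨y, ?_, hx1, le_rfl⟩, ?_, ?_⟩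
    · by_cases e : far (h y) b = q
      · exact Or.inl e
      rcases ahead_total (h y) e with h4 | h4
      · exact Or.inr h4
      · have := hx3 q h1 h4; omega
    · have hpy : p ≠ y := fun e => by rw [e] at hp2; omega
      rcases ahead_total (h y) hpy with h4 | h4
      · exact h4
      · have := h3 p h4 (ahead_succ.1 hp1); omega
    · rw [hh.entry_succ, if_pos hp2, hpa]
    · rw [hh.entry_of_nbr hx le_rfl]; exact hb

/-! ### Heap labellings -/

/-- A labelling of the columns by coefficients, with only the column `r` (the root) left without label, such
that, for every label `g` of a column `x`, the coefficients whose gaps lie between `x` and the gap of `g` are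
larger than `g`. -/
structure HeapLabelling (lt : Fin t → Fin t → Prop) (a : Fin (t + 1) → Option (Fin t))
    (r : Fin (t + 1)) : Prop where
  eq_none_iff : ∀ x, a x = none ↔ x = r
  inj : ∀ x y g, a x = some g → a y = some g → x = y
  lt_of_gapBetween : ∀ x g j, a x = some g → GapBetween x g j → lt g j

theorem HeapLabelling.surj {lt : Fin t → Fin t → Prop} {a : Fin (t + 1) → Option (Fin t)}
    {r : Fin (t + 1)} (ha : HeapLabelling lt a r) (g : Fin t) : ∃ x, a x = some g := by
  have hinj : Function.Injective a := by
    intro x y hxy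
    cases hx : a x with
    | none => exact ((ha.eq_none_iff x).1 hx).trans ((ha.eq_none_iff y).1 (hxy.symm.trans hx)).symm
    | some b => exact ha.inj x y b hx (hxy ▸ hx)
  exact ((Fintype.bijective_iff_injective_and_card a).2 ⟨hinj, by simp⟩).2 (some g)

theorem IsComplete.lt_of_between {lt : Fin t → Fin t → Prop}
    (htr : ∀ a b c, lt a b → lt b c → lt a c) {h : Fin (t + 1) → ℕ}
    (hc : IsComplete h) (hlt : ∀ a b, TableauRel h a b → lt a b) {x y : Fin (t + 1)} {g u : Fin t}
    (hx : topLabel h x = some g) (hy : topLabel h y = some u) (hb : Between x g y) : lt g u := by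
  obtain ⟨hx1, hx2, hx3⟩ := hc.topLabel_spec hx
  have hv := far_val (h x) g
  induction hn : h x - h y generalizing y u with
  | zero => have := hx1 y hb; omega
  | succ n ih =>
    have hyx := hx1 y hb
    have hxm := le_maxHeight h x
    obtain ⟨q, hq⟩ := hc y (by omega)
    obtain ⟨hq1, hq2, hq3⟩ := id hq
    have e1 := hq3 x
    have e2 := hq3 (far (h x) g)
    have hqz : q = far (h x) g → h x = h y + 1 := fun e => by rw [e] at hq2; omega
    have key : q = x ∨ Between x g q := by
      rw [Fin.ext_iff] at hqz ⊢
      unfold Ahead at hq1 e1 e2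
      unfold Between at hb ⊢
      split_ifs at hv <;> omega
    rcases key with rfl | hbq
    · exact hlt _ _ (hc.tableauRel_iff.2 ⟨y, q, hq, hx, hy⟩)
    · cases hl : topLabel h q with
      | none =>
        have := hc.admissible.topLabel_eq_none hl
        have h1 := hx1 q hbq
        rw [this, (strongColumn_spec h).1] at h1
        omega
      | some w =>
        have h1 : lt g w := ih hl hbq (by omega)
        exact htr _ _ _ h1 (hlt _ _ (hc.tableauRel_iff.2 ⟨y, q, hq, hl, hy⟩))

/-- The diagram is complete and its partial order lifts to `lt` if and only if its top labels form a heap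
labelling: the columns between a column and the gap of its label are its descendants. -/
theorem IsComplete.heapLabelling_iff {lt : Fin t → Fin t → Prop}
    (htr : ∀ a b c, lt a b → lt b c → lt a c) {h : Fin (t + 1) → ℕ} (hc : IsComplete h) :
    (∀ a b, TableauRel h a b → lt a b) ↔ HeapLabelling lt (topLabel h) (strongColumn h) := by
  constructor
  · intro hlt
    refine ⟨fun x => ⟨hc.admissible.topLabel_eq_none, fun e => by rw [e]; exact topLabel_strongColumn h⟩,
      fun x y g => topLabel_injective, fun x g j hx hb => ?_⟩
    obtain ⟨y, hy⟩ := hc.admissible.exists_topLabel j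
    refine hc.lt_of_between htr hlt hx hy ?_
    obtain ⟨hx1, hx2, hx3⟩ := hc.topLabel_spec hx
    obtain ⟨hy1, hy2, hy3⟩ := hc.topLabel_spec hy
    have hv := far_val (h x) g
    have hw := far_val (h y) j
    have e1 := hx1 (far (h y) j)
    have e2 := hy1 x
    have e3 := hy1 (far (h x) g)
    have e4 : far (h y) j = x → h (far (h y) j) = h x := fun e => by rw [e]
    have e5 : y = far (h x) g → h y = h (far (h x) g) := fun e => congrArg h e
    have e6 : y = x → g = j := fun e => by rw [e, hx] at hy; exact Option.some.inj hy
    simp only [Fin.ext_iff] at e4 e5 e6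
    unfold GapBetween at hb
    unfold Between at *
    by_contra hcon
    split_ifs at hv hw <;> omega
  · intro hH a b hab
    obtain ⟨y, q, ⟨hq1, hq2, hq3⟩, ha, hb⟩ := hc.tableauRel_iff.1 hab
    refine hH.lt_of_gapBetween q a b ha ?_
    obtain ⟨hx1, hx2, hx3⟩ := hc.topLabel_spec ha
    obtain ⟨hy1, hy2, hy3⟩ := hc.topLabel_spec hb
    have hv := far_val (h q) a
    have e1 := hq3 (far (h q) a)
    have e2 := hy1 q
    have e3 : far (h q) a = y → h (far (h q) a) = h y := fun e => by rw [e]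
    have e4 : a = b → q = y := fun e => topLabel_injective ha (e ▸ hb)
    have e5 : q = y → h q = h y := fun e => by rw [e]
    simp only [Fin.ext_iff] at e3 e4 e5
    unfold Between at *
    unfold Ahead at *
    unfold GapBetween
    split_ifs at hv <;> omega

/-! ### Complete reduced representatives -/

theorem H.topLabel_mk (D : Diagram t) : (H.mk D).topLabel = Preparation.topLabel D.ht := rfl

theorem H.index_mk (D : Diagram t) : (H.mk D).index = strongColumn D.ht := rfl

theorem maxHeight_addBlocks_two {h : Fin (t + 1) → ℕ} {i : Fin (t + 1)} (hi : CanAdjoinDomino h i) :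
    maxHeight (addBlocks h i 2) = maxHeight h := by
  obtain ⟨j, -, hj, -⟩ := canAdjoinDomino_iff.1 hi
  obtain ⟨r, hr⟩ := exists_maxHeight h
  have hjm := le_maxHeight h j
  refine maxHeight_eq r ?_ fun k => ?_
  · rw [addBlocks_apply, if_neg, hr]
    rintro rfl; omega
  · have := le_maxHeight h k
    rw [addBlocks_apply]
    split_ifs <;> omega

theorem Admissible.addBlocks_two {h : Fin (t + 1) → ℕ} (hh : Admissible h) {i : Fin (t + 1)}
    (hi : CanAdjoinDomino h i) : Admissible (addBlocks h i 2) := by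
  have hle : ∀ k, h k ≤ addBlocks h i 2 k := fun k => by
    rw [addBlocks_apply]
    split_ifs with e
    · rw [e]; omega
    · rfl
  intro l hl
  rw [maxHeight_addBlocks_two hi] at hl
  by_cases hli : l = i
  · subst hli
    obtain ⟨j, h1, h2, -⟩ := canAdjoinDomino_iff.1 hi
    have hv : addBlocks h l 2 l = h l + 2 := by rw [addBlocks_apply, if_pos rfl]
    rw [hv] at hl ⊢
    have hd : ∀ {a b : Fin (t + 1)}, Ahead (h l + 2) a b ↔ Ahead (h l) a b := ahead_congr (by omega)
    by_cases hj : h l + 2 < h j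
    · exact ⟨j, hd.2 h1, hj.trans_le (hle j)⟩
    · have hjl : h j = h l + 2 := by omega
      obtain ⟨k, h3, h4⟩ := hh j (by omega)
      rw [hjl] at h3 h4
      exact ⟨k, hd.2 (h1.trans (hd.1 h3)), h4.trans_le (hle k)⟩
  · have hv : addBlocks h i 2 l = h l := by rw [addBlocks_apply, if_neg hli]
    rw [hv] at hl ⊢
    obtain ⟨k, h3, h4⟩ := hh l hl
    exact ⟨k, h3, h4.trans_le (hle k)⟩

/-- Every diagram can be completed by dominoes; as these do not change the maximal height, there is room for
finitely many only. -/
theorem exists_complete (D : Diagram t) : ∃ D' : Diagram t, H.mk D' = H.mk D ∧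
    IsComplete D'.ht ∧ maxHeight D'.ht = maxHeight D.ht := by
  induction hn : ∑ k, (maxHeight D.ht - D.ht k) using Nat.strong_induction_on generalizing D with
  | _ n ih =>
    by_cases hc : D.Complete
    · exact ⟨D, rfl, D.complete_iff.1 hc, rfl⟩
    · unfold Diagram.Complete at hc
      push Not at hc
      obtain ⟨i, hi⟩ := hc
      have hm := maxHeight_addBlocks_two hi
      let E : Diagram t := Diagram.ofAdmissible _ (D.admissible.addBlocks_two hi)
      have hE : E.ht = addBlocks D.ht i 2 := rfl
      have hlt : ∑ k, (maxHeight E.ht - E.ht k) < n := by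
        rw [← hn, hE, hm]
        refine Finset.sum_lt_sum (fun k _ => ?_) ⟨i, Finset.mem_univ i, ?_⟩
        · rw [addBlocks_apply]
          split_ifs with e
          · rw [e]; omega
          · rfl
        · obtain ⟨j, -, hj, -⟩ := canAdjoinDomino_iff.1 hi
          have := le_maxHeight D.ht j
          rw [addBlocks_apply, if_pos rfl]
          omega
      obtain ⟨D', h1, h2, h3⟩ := ih _ hlt E rfl
      exact ⟨D', h1.trans (Quot.sound (Step.domino D E i hi hE)).symm, h2, h3.trans hm⟩

theorem Admissible.addBlocks_strongColumn {h : Fin (t + 1) → ℕ} (hh : Admissible h) :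
    Admissible (addBlocks h (strongColumn h) 1) := by
  have hr := (strongColumn_spec h).1
  have hr' : addBlocks h (strongColumn h) 1 (strongColumn h) = maxHeight h + 1 := by
    rw [addBlocks_apply, if_pos rfl, hr]
  intro l hl
  rw [maxHeight_addBlocks_strongColumn] at hl
  have hne : l ≠ strongColumn h := fun e => by rw [e, hr'] at hl; omega
  have hv : addBlocks h (strongColumn h) 1 l = h l := by rw [addBlocks_apply, if_neg hne]
  rw [hv] at hl ⊢
  by_cases hlm : h l = maxHeight h
  · refine ⟨strongColumn h, ?_, by omega⟩
    rw [hlm]; exact ahead_strongColumn hlm hne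
  · obtain ⟨k, h1, h2⟩ := hh l (by omega)
    refine ⟨k, h1, h2.trans_le ?_⟩
    rw [addBlocks_apply]
    split_ifs with e
    · rw [e]; omega
    · rfl

/-- In a complete diagram every height between that of a column and the maximal height occurs. -/
theorem IsComplete.exists_ht {h : Fin (t + 1) → ℕ} (hc : IsComplete h) {x : Fin (t + 1)} {s : ℕ}
    (h1 : h x ≤ s) (h2 : s ≤ maxHeight h) : ∃ k, h k = s := by
  induction s, h1 using Nat.le_induction with
  | base => exact ⟨x, rfl⟩
  | succ s h1 ih =>
    obtain ⟨k, hk⟩ := ih (by omega)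
    obtain ⟨q, -, hq, -⟩ := hc k (by omega)
    exact ⟨q, by omega⟩

/-- The two lowest rows of a complete diagram can be removed if they are full. -/
theorem exists_low (D : Diagram t) (hc : IsComplete D.ht) : ∃ D' : Diagram t, H.mk D' = H.mk D ∧
    IsComplete D'.ht ∧ (∃ k, D'.ht k ≤ 1) ∧ maxHeight D'.ht % 2 = maxHeight D.ht % 2 := by
  induction hn : maxHeight D.ht using Nat.strong_induction_on generalizing D with
  | _ n ih =>
    by_cases hl : ∃ k, D.ht k ≤ 1
    · exact ⟨D, rfl, hc, hl, by rw [hn]⟩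
    · push Not at hl
      have hm : maxHeight (fun k => D.ht k - 2) = maxHeight D.ht - 2 := by
        obtain ⟨r, hr⟩ := exists_maxHeight D.ht
        exact maxHeight_eq r (by simp only [hr]) fun k => by
          have := le_maxHeight D.ht k
          omega
      have hc' : IsComplete fun k => D.ht k - 2 := by
        intro y hy
        rw [hm] at hy
        change D.ht y - 2 < _ at hy
        have h2 := hl y
        obtain ⟨q, h3, h4, h5⟩ := hc y (by omega)
        have hd : ∀ {a b : Fin (t + 1)}, Ahead (D.ht y - 2) a b ↔ Ahead (D.ht y) a b :=
          ahead_congr (by omega)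
        refine ⟨q, hd.2 h3, by simp only; omega, fun k h6 h7 => ?_⟩
        have := h5 k (hd.1 h6) (hd.1 h7)
        simp only; omega
      let E : Diagram t := Diagram.ofAdmissible _ hc'.admissible
      have hE : E.ht = fun k => if 0 + 2 ≤ D.ht k then D.ht k - 2 else D.ht k := by
        funext k
        have := hl k
        rw [if_pos (by omega)]; rfl
      have hstep : Step D E := Step.removeRows D E 0 (fun k => by have := hl k; omega) hE
      have hr := hl 0
      have hr' := le_maxHeight D.ht 0
      have hmE : maxHeight E.ht = maxHeight D.ht - 2 := hm
      obtain ⟨D', h1, h2, h3, h4⟩ := ih (maxHeight E.ht) (by omega) E hc' rfl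
      exact ⟨D', h1.trans (Quot.sound hstep).symm, h2, h3, by omega⟩

/-- Every class has a complete diagram with a column of height at most `1` and maximal height of a given
parity, which a half-domino changes. -/
theorem exists_complete_of_parity (X : H t) (b : ℕ) : ∃ D : Diagram t, H.mk D = X ∧
    IsComplete D.ht ∧ (∃ k, D.ht k ≤ 1) ∧ maxHeight D.ht % 2 = b % 2 := by
  obtain ⟨D, rfl⟩ := X.exists_mk
  have key : ∃ D' : Diagram t, H.mk D' = H.mk D ∧ maxHeight D'.ht % 2 = b % 2 := by
    by_cases hb : maxHeight D.ht % 2 = b % 2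
    · exact ⟨D, rfl, hb⟩
    · let E : Diagram t := Diagram.ofAdmissible _ D.admissible.addBlocks_strongColumn
      have hm : maxHeight E.ht = maxHeight D.ht + 1 := maxHeight_addBlocks_strongColumn D.ht
      exact ⟨E, (Quot.sound (Step.halfDomino D E rfl)).symm, by omega⟩
  obtain ⟨D₁, h1, h2⟩ := key
  obtain ⟨D₂, h3, h4, h5⟩ := exists_complete D₁
  obtain ⟨D₃, h6, h7, h8, h9⟩ := exists_low D₂ h4
  exact ⟨D₃, h6.trans (h3.trans h1), h7, h8, by omega⟩

theorem IsComplete.reduced {D : Diagram t} (hc : IsComplete D.ht) (hl : ∃ k, D.ht k ≤ 1) :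
    D.Reduced := by
  obtain ⟨k, hk⟩ := hl
  exact fun s h1 h2 => hc.exists_ht (x := k) (by omega) h2.le

/-! ### The top labels determine the class -/

theorem IsComplete.between_of_isParent {h : Fin (t + 1) → ℕ} (hc : IsComplete h)
    {y q : Fin (t + 1)} (hq : IsParent h y q) {a : Fin t} (ha : topLabel h q = some a) :
    Between q a y := by
  obtain ⟨hq1, hq2, hq3⟩ := hq
  obtain ⟨hx1, hx2, hx3⟩ := hc.topLabel_spec ha
  have hv := far_val (h q) a
  have e1 := hq3 (far (h q) a)
  have e3 : far (h q) a = y → h (far (h q) a) = h y := fun e => by rw [e]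
  simp only [Fin.ext_iff] at e3
  unfold Between
  unfold Ahead at *
  split_ifs at hv <;> omega

/-- The depths below the maximal height in two complete diagrams with the same top labels can be compared
when the maximal heights have the same parity: a parent in one diagram is an ancestor in the other. -/
theorem IsComplete.ht_add_le {h h' : Fin (t + 1) → ℕ} (hc : IsComplete h) (hc' : IsComplete h')
    (hl : topLabel h = topLabel h') (hm : maxHeight h % 2 = maxHeight h' % 2) (x : Fin (t + 1)) :
    maxHeight h' + h x ≤ maxHeight h + h' x := by
  induction hn : maxHeight h - h x using Nat.strong_induction_on generalizing x with
  | _ n ih =>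
    have hxm := le_maxHeight h x
    have hxm' := le_maxHeight h' x
    by_cases hx : h' x = maxHeight h'
    · omega
    obtain ⟨q, hq⟩ := hc' x (by omega)
    have hq2 := hq.2.1
    cases ha : topLabel h' q with
    | none =>
      have hqm : h' q = maxHeight h' := by
        rw [hc'.admissible.topLabel_eq_none ha, (strongColumn_spec h').1]
      cases hb : topLabel h' x with
      | none =>
        rw [hc'.admissible.topLabel_eq_none hb, (strongColumn_spec h').1] at hx
        exact absurd rfl hx
      | some g =>
        have h1 := (hc'.topLabel_spec hb).2.2
        rw [← hl] at hb
        have h2 := (hc.topLabel_spec hb).2.2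
        omega
    | some a =>
      have hb := hc'.between_of_isParent hq ha
      rw [← hl] at ha
      have h1 := (hc.topLabel_spec ha).1 x hb
      have := ih _ (by have := le_maxHeight h q; omega) q rfl
      omega

theorem H.ext_topLabel {X Y : H t} (hl : X.topLabel = Y.topLabel) : X = Y := by
  obtain ⟨D, rfl, hc, ⟨k, hk⟩, hm⟩ := exists_complete_of_parity X 0
  obtain ⟨D', rfl, hc', ⟨k', hk'⟩, hm'⟩ := exists_complete_of_parity Y 0
  have h1 := hc.ht_add_le hc' hl (by omega)
  have h2 := hc'.ht_add_le hc hl.symm (by omega)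
  have hmm : maxHeight D.ht = maxHeight D'.ht := by
    have := h1 k; have := h1 k'; have := h2 k; have := h2 k'
    omega
  have : D = D' := Diagram.ext (funext fun x => by
    have := h1 x; have := h2 x; omega)
  rw [this]

theorem mem_HSector_iff {lt : Fin t → Fin t → Prop} (htr : ∀ a b c, lt a b → lt b c → lt a c)
    {X : H t} : X ∈ HSector lt ↔ HeapLabelling lt X.topLabel X.index := by
  constructor
  · rintro ⟨D, rfl, hD, hlt⟩
    exact ((D.complete_iff.1 hD).heapLabelling_iff htr).1 hlt
  · intro hX
    obtain ⟨D, rfl, hc, -, -⟩ := exists_complete_of_parity X 0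
    exact ⟨D, rfl, D.complete_iff.2 hc, (hc.heapLabelling_iff htr).2 hX⟩

/-! ### Combinatorics of heap labellings -/

/-- The gap of the coefficient `j` separates the columns `x` and `y`. -/
def Separates (j : Fin t) (x y : Fin (t + 1)) : Prop :=
  (x.val ≤ j.val ∧ j.val < y.val) ∨ (y.val ≤ j.val ∧ j.val < x.val)

namespace HeapLabelling

variable {lt : Fin t → Fin t → Prop} {a : Fin (t + 1) → Option (Fin t)} {r : Fin (t + 1)}

/-- Cut the base line at the gaps outside an upper set `P` of coefficients.  The coefficients whose gaps lie
inside a piece are labels of columns of that piece, so exactly one column of a piece is the root or has its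
label outside `P`: two such columns are separated by a gap outside `P`. -/
theorem eq_of_separates (ha : HeapLabelling lt a r) {P : Fin t → Prop}
    (hP : ∀ i j, P i → lt i j → P j) {x y : Fin (t + 1)} (hx : ∀ g, a x = some g → ¬ P g)
    (hy : ∀ g, a y = some g → ¬ P g) (hxy : ∀ j, Separates j x y → P j) : x = y := by
  classical
  by_contra hne
  set S : Finset (Fin (t + 1)) := Finset.univ.filter fun z => ∀ j, Separates j x z → P j with hS
  set G : Finset (Fin t) := Finset.univ.filter fun j => j.castSucc ∈ S ∧ j.succ ∈ S with hG
  have hmem : ∀ z, z ∈ S ↔ ∀ j, Separates j x z → P j := fun z => by simp [hS]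
  have hxS : x ∈ S := (hmem x).2 fun j hj => by unfold Separates at hj; omega
  have hyS : y ∈ S := (hmem y).2 hxy
  have hGP : ∀ j ∈ G, P j := fun j hj => by
    simp only [hG, Finset.mem_filter, Finset.mem_univ, true_and, hmem] at hj
    by_cases hxj : x.val ≤ j.val
    · exact hj.2 j (by unfold Separates; simp only [Fin.val_succ]; omega)
    · exact hj.1 j (by unfold Separates; simp only [Fin.val_castSucc]; omega)
  choose e he using ha.surj
  have heinj : Function.Injective e := fun i j hij => by
    have h1 := he i
    rw [hij, he j] at h1
    exact (Option.some.inj h1).symm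
  have hsub : G.image e ⊆ (S.erase x).erase y := by
    intro z hz
    obtain ⟨j, hj, rfl⟩ := Finset.mem_image.1 hz
    have hPj := hGP j hj
    refine Finset.mem_erase.2 ⟨fun h => hy j (h ▸ he j) hPj,
      Finset.mem_erase.2 ⟨fun h => hx j (h ▸ he j) hPj, (hmem _).2 fun i hi => ?_⟩⟩
    simp only [hG, Finset.mem_filter, Finset.mem_univ, true_and, hmem] at hj
    by_cases hij : i = j
    · exact hij ▸ hPj
    have hij' : i.val ≠ j.val := fun h => hij (Fin.ext h)
    by_cases h1 : GapBetween (e j) j i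
    · exact hP j i hPj (ha.lt_of_gapBetween _ _ _ (he j) h1)
    by_cases h2 : Separates i x j.castSucc
    · exact hj.1 i h2
    · refine hj.2 i ?_
      unfold Separates GapBetween at *
      simp only [Fin.val_succ, Fin.val_castSucc] at *
      omega
  have hcard1 : G.card + 2 ≤ S.card := by
    have h1 := Finset.card_le_card hsub
    rw [Finset.card_image_of_injective _ heinj, Finset.card_erase_of_mem
      (Finset.mem_erase.2 ⟨Ne.symm hne, hyS⟩), Finset.card_erase_of_mem hxS] at h1
    have : 1 < S.card := Finset.one_lt_card.2 ⟨x, hxS, y, hyS, hne⟩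
    omega
  have hcard2 : S.card ≤ G.card + 1 := by
    set M := S.max' ⟨x, hxS⟩
    have hM : M ∈ S := S.max'_mem _
    have hsub : S ⊆ insert M (G.image Fin.castSucc) := by
      intro z hz
      by_cases hzM : z = M
      · simp [hzM]
      have hlt : z.val < M.val :=
        lt_of_le_of_ne (Fin.le_def.1 (S.le_max' z hz)) fun h => hzM (Fin.ext h)
      have hzt : z.val < t := by have := M.isLt; omega
      refine Finset.mem_insert_of_mem (Finset.mem_image.2 ⟨⟨z.val, hzt⟩, ?_, rfl⟩)
      simp only [hG, Finset.mem_filter, Finset.mem_univ, true_and]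
      refine ⟨hz, (hmem _).2 fun j hj => ?_⟩
      by_cases h1 : Separates j x z
      · exact (hmem z).1 hz j h1
      · refine (hmem M).1 hM j ?_
        unfold Separates at *
        simp only [Fin.val_succ] at hj
        omega
    calc S.card ≤ _ := Finset.card_le_card hsub
      _ ≤ (G.image Fin.castSucc).card + 1 := Finset.card_insert_le _ _
      _ ≤ G.card + 1 := by have := Finset.card_image_le (s := G) (f := Fin.castSucc); omega
  omega

theorem root_eq_none (ha : HeapLabelling lt a r) : a r = none := (ha.eq_none_iff r).2 rfl

/-- Moving the root to the column with label `i` gives a heap labelling if all the gaps between the root and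
the gap of `i` are larger than `i`. -/
theorem swap (ha : HeapLabelling lt a r) {i : Fin t} {k : Fin (t + 1)} (hk : a k = some i)
    (hact : ∀ j, GapBetween r i j → lt i j) {b : Fin (t + 1) → Option (Fin t)} (hbk : b k = none)
    (hbr : b r = some i) (hb : ∀ x, x ≠ r → x ≠ k → b x = a x) : HeapLabelling lt b k := by
  have hcase : ∀ x g, b x = some g → (x = r ∧ g = i) ∨ (x ≠ r ∧ x ≠ k ∧ a x = some g) := by
    intro x g hx
    by_cases hxr : x = r
    · rw [hxr, hbr] at hx
      exact Or.inl ⟨hxr, (Option.some.inj hx).symm⟩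
    · have hxk : x ≠ k := fun e => by rw [e, hbk] at hx; cases hx
      exact Or.inr ⟨hxr, hxk, by rw [← hb x hxr hxk, hx]⟩
  refine ⟨fun x => ⟨fun hx => ?_, fun hx => hx ▸ hbk⟩, fun x y g hx hy => ?_,
    fun x g j hx hj => ?_⟩
  · by_contra hxk
    by_cases hxr : x = r
    · rw [hxr, hbr] at hx; cases hx
    · rw [hb x hxr hxk] at hx
      exact hxr ((ha.eq_none_iff x).1 hx)
  · rcases hcase x g hx with ⟨rfl, rfl⟩ | ⟨h1, h2, h3⟩ <;>
      rcases hcase y g hy with ⟨h4, h5⟩ | ⟨h4, h5, h6⟩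
    · exact h4.symm
    · exact absurd (ha.inj _ _ _ h6 hk) h5
    · exact absurd (ha.inj _ _ _ h3 (h5 ▸ hk)) h2
    · exact ha.inj _ _ _ h3 h6
  · rcases hcase x g hx with ⟨rfl, rfl⟩ | ⟨-, -, hax⟩
    · exact hact j hj
    · exact ha.lt_of_gapBetween x g j hax hj

variable [IsStrictTotalOrder (Fin t) lt]

/-- If all gaps between the root and the gap of `i` are larger than `i`, then the column with label `i` is
on the other side of that gap. -/
theorem separates_root (ha : HeapLabelling lt a r) {i : Fin t} {k : Fin (t + 1)}
    (hk : a k = some i) (hact : ∀ j, GapBetween r i j → lt i j) : Separates i r k := by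
  by_contra hs
  have hrk : r = k := by
    refine ha.eq_of_separates (P := lt i) (fun _ _ => trans_of lt) (fun g hg => ?_)
      (fun g hg => ?_) fun j hj => ?_
    · rw [ha.root_eq_none] at hg; cases hg
    · rw [hk, Option.some.injEq] at hg
      exact hg ▸ irrefl_of lt i
    · by_cases h1 : GapBetween r i j
      · exact hact j h1
      · refine ha.lt_of_gapBetween k i j hk ?_
        unfold Separates GapBetween at *
        omega
  rw [← hrk, ha.root_eq_none] at hk
  cases hk

/-- All the gaps which separate the root from the column with label `i` are at least `i`. -/
theorem lt_of_separates_root (ha : HeapLabelling lt a r) {i j : Fin t} {k : Fin (t + 1)}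
    (hk : a k = some i) (hact : ∀ j, GapBetween r i j → lt i j) (hj : Separates j r k)
    (hji : j ≠ i) : lt i j := by
  have h1 := ha.separates_root hk hact
  have hji' : j.val ≠ i.val := fun h => hji (Fin.ext h)
  by_cases h2 : GapBetween r i j
  · exact hact j h2
  · refine ha.lt_of_gapBetween k i j hk ?_
    unfold Separates GapBetween at *
    omega

end HeapLabelling

/-! ### Links -/

/-- The top labels of `X` and `Y` differ by moving the label `i` from the index of `Y` to that of `X`. -/
structure Exchange (X Y : H t) (i : Fin t) : Prop where
  ne : X.index ≠ Y.index
  left : X.topLabel Y.index = some i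
  right : Y.topLabel X.index = some i
  eq : ∀ x, x ≠ X.index → x ≠ Y.index → X.topLabel x = Y.topLabel x

theorem Exchange.symm {X Y : H t} {i : Fin t} (h : Exchange X Y i) : Exchange Y X i :=
  ⟨h.ne.symm, h.right, h.left, fun x h1 h2 => (h.eq x h2 h1).symm⟩

theorem H.topLabel_eq_none_iff (X : H t) {x : Fin (t + 1)} : X.topLabel x = none ↔ x = X.index := by
  obtain ⟨D, rfl⟩ := X.exists_mk
  exact ⟨D.admissible.topLabel_eq_none, fun e => by rw [e]; exact topLabel_strongColumn D.ht⟩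

theorem H.topLabel_inj (X : H t) {x y : Fin (t + 1)} {g : Fin t} (hx : X.topLabel x = some g)
    (hy : X.topLabel y = some g) : x = y := by
  obtain ⟨D, rfl⟩ := X.exists_mk
  exact topLabel_injective hx hy

theorem maxHeight_addBlocks_one {h : Fin (t + 1) → ℕ} {k : Fin (t + 1)}
    (hk : h k + 1 = maxHeight h) : maxHeight (addBlocks h k 1) = maxHeight h := by
  refine maxHeight_eq k (by rw [addBlocks_apply, if_pos rfl, hk]) fun l => ?_
  have := le_maxHeight h l
  rw [addBlocks_apply]
  split_ifs <;> omega

theorem strongColumn_addBlocks_one {h : Fin (t + 1) → ℕ} {k : Fin (t + 1)}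
    (hk : h k + 1 = maxHeight h) (hl : ∀ l, Ahead (maxHeight h) k l → h l < maxHeight h) :
    strongColumn (addBlocks h k 1) = k := by
  have hm := maxHeight_addBlocks_one hk
  refine strongColumn_eq_of_last (by rw [hm, addBlocks_apply, if_pos rfl, hk]) fun l hkl => ?_
  rw [hm] at hkl ⊢
  rw [addBlocks_apply, if_neg]
  · exact hl l hkl
  · rintro rfl; exact Ahead.irrefl hkl

theorem state_addBlocks_one (h : Fin (t + 1) → ℕ) (k : Fin (t + 1)) :
    state (addBlocks h k 1) (h k) = state h (h k) := state_congr fun n hn l => by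
  rw [addBlocks_apply]
  split_ifs with e
  · rw [e]; omega
  · rfl

/-- Suppose that column `k` becomes the strongly extremal one when a block is put on it, without the diagram
getting higher.  The block is then the last one of the top row, so this row behaves as before except that the
entry of the block passes to the former strongly extremal column. -/
theorem topLabel_addBlocks_one {h : Fin (t + 1) → ℕ} {k : Fin (t + 1)}
    (hk : h k + 1 = maxHeight h) (hl : ∀ l, Ahead (maxHeight h) k l → h l < maxHeight h) :
    topLabel (addBlocks h k 1) (strongColumn h) = topLabel h k ∧
    ∀ x, x ≠ strongColumn h → x ≠ k → topLabel (addBlocks h k 1) x = topLabel h x := by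
  have hst := state_addBlocks_one h k
  obtain ⟨hr, -⟩ := strongColumn_spec h
  have hv : ∀ l, l ≠ k → addBlocks h k 1 l = h l := fun l hlk => by
    rw [addBlocks_apply, if_neg hlk]
  have hvk : addBlocks h k 1 k = h k + 1 := by rw [addBlocks_apply, if_pos rfl]
  have hrk : strongColumn h ≠ k := fun e => by rw [e] at hr; omega
  have hahead : Ahead (maxHeight h) (strongColumn h) k := by
    rcases ahead_total (maxHeight h) hrk with h1 | h1
    · exact h1
    · have := hl _ h1; omega
  have hle := le_maxHeight h
  constructor
  · have hn : nbr (addBlocks h k 1) (h k + 1) (strongColumn h) = some k := by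
      refine nbr_eq_some.2 ⟨hk ▸ hahead, hvk.ge, fun l h1 h2 => ?_⟩
      rw [hv l (by rintro rfl; exact Ahead.irrefl h2)]
      rw [hk] at h1 ⊢
      exact not_ahead_strongColumn h h1
    rw [topLabel, hv _ hrk, hr, ← hk, state_succ_of_le (by rw [hv _ hrk, hr, hk]), hn,
      Option.bind_some, hst, topLabel]
  · intro x hxr hxk
    by_cases hx : h x ≤ h k
    · rw [← state_eq_topLabel (n := h k) ((hv x hxk).trans_le hx), hst, state_eq_topLabel hx]
    · have hxm : h x = maxHeight h := by have := hle x; omega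
      have hxr' := ahead_strongColumn hxm hxr
      have hn : nbr (addBlocks h k 1) (h k + 1) x = nbr h (h k + 1) x := by
        cases hnx : nbr h (h k + 1) x with
        | none =>
          have := nbr_eq_none.1 hnx (strongColumn h) (hk ▸ hxr')
          omega
        | some p =>
          obtain ⟨h1, h2, h3⟩ := nbr_spec hnx
          have hpk : p ≠ k := fun e => by rw [e] at h2; omega
          refine nbr_eq_some.2 ⟨h1, by rw [hv p hpk]; exact h2, fun l h4 h5 => ?_⟩
          by_cases hlk : l = k
          · subst hlk
            rw [hk] at h4 h5 h3
            have := h3 (strongColumn h) hxr' (hahead.trans h5)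
            omega
          · rw [hv l hlk]; exact h3 l h4 h5
      rw [topLabel, topLabel, hv x hxk, hxm, ← hk, state_succ_of_le (by rw [hv x hxk]; omega),
        state_succ_of_le (by omega), hn, hst]

theorem Link.exchange {X Y : H t} {i : Fin t} (hL : Link X Y i) : Exchange X Y i := by
  obtain ⟨D', D, k, rfl, rfl, -, -, hD, hne, hk, hi⟩ := hL
  rw [H.index_mk] at hne hk
  have hle' := le_maxHeight D'.ht
  have hle := le_maxHeight D.ht
  obtain ⟨hr, -⟩ := strongColumn_spec D'.ht
  have hm := (strongColumn_spec D.ht).1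
  have hv : ∀ l, l ≠ k → D.ht l = D'.ht l := fun l hlk => by
    rw [hD, addBlocks_apply, if_neg hlk]
  have hvk : D.ht k = D'.ht k + 1 := by rw [hD, addBlocks_apply, if_pos rfl]
  rw [hk] at hm
  have hrD := hle (strongColumn D'.ht)
  rw [hv _ hne] at hrD
  have hkm : D'.ht k + 1 = maxHeight D'.ht := by
    by_contra hcon
    have hkm : D'.ht k = maxHeight D'.ht := by have := hle' k; omega
    obtain ⟨l, h1, h2⟩ := D.admissible (strongColumn D'.ht) (by rw [hv _ hne]; omega)
    rw [hv _ hne, hr] at h1 h2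
    by_cases hlk : l = k
    · have := not_ahead_strongColumn _ (hlk ▸ h1); omega
    · rw [hv l hlk] at h2; have := hle' l; omega
  have hmm : maxHeight D.ht = maxHeight D'.ht := by omega
  have hlast : ∀ l, Ahead (maxHeight D'.ht) k l → D'.ht l < maxHeight D'.ht := fun l hl => by
    rw [← hv l (by rintro rfl; exact Ahead.irrefl hl), ← hmm]
    rw [← hmm, ← hk] at hl
    exact not_ahead_strongColumn _ hl
  obtain ⟨h1, h2⟩ := topLabel_addBlocks_one hkm hlast
  rw [hvk, D.admissible.entry_succ, if_pos hvk.ge, hD, state_addBlocks_one] at hi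
  rw [← hD] at h1 h2
  refine ⟨by rw [H.index_mk, H.index_mk, hk]; exact hne, ?_, ?_, ?_⟩
  · rw [H.index_mk, hk]; exact hi
  · exact h1.trans hi
  · intro x hx1 hx2
    rw [H.index_mk] at hx1 hx2
    rw [hk] at hx2
    exact (h2 x hx1 hx2).symm

/-- The root of a class in the sector can be moved along the label `i` by a link if all the gaps between
the root and the gap of `i` are larger than `i`: the column with label `i` is then a child of the root, so
it can be raised by one block in a complete reduced representative in which it is lower than the root. -/
theorem exists_link {lt : Fin t → Fin t → Prop} [IsStrictTotalOrder (Fin t) lt] {X : H t}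
    (hX : HeapLabelling lt X.topLabel X.index) {i : Fin t}
    (hact : ∀ j, GapBetween X.index i j → lt i j) :
    ∃ Y : H t, HeapLabelling lt Y.topLabel Y.index ∧ Link X Y i := by
  obtain ⟨k, hk⟩ := hX.surj i
  -- the height of column `k` is even exactly if `k ≤ i`; by the choice of the parity of the height of the
  -- diagram it cannot be maximal
  obtain ⟨D, rfl, hc, hlow, hm⟩ := exists_complete_of_parity X (if k.val ≤ i.val then 1 else 0)
  rw [H.index_mk] at hact
  have htr : ∀ a b c, lt a b → lt b c → lt a c := fun _ _ _ => trans_of lt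
  have hheap := (hc.heapLabelling_iff htr).2 hX
  have hpar := (hc.topLabel_spec hk).2.2
  have hkm : D.ht k < maxHeight D.ht := by
    refine lt_of_le_of_ne (le_maxHeight _ k) fun e => ?_
    split_ifs at hm <;> omega
  obtain ⟨q, hq⟩ := hc k hkm
  have hqr : q = strongColumn D.ht := by
    cases hql : topLabel D.ht q with
    | none => exact hc.admissible.topLabel_eq_none hql
    | some l =>
      have hli : lt l i := hheap _ _ (hc.tableauRel_iff.2 ⟨k, q, hq, hql, hk⟩)
      have hb := hc.between_of_isParent hq hql
      refine hX.eq_of_separates (P := lt l) (fun _ _ => htr _ _ _) (fun g hg => ?_)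
        (fun g hg => ?_) fun j hj => ?_
      · rw [H.topLabel_mk, hql, Option.some.injEq] at hg
        exact hg ▸ irrefl_of lt l
      · rw [H.topLabel_mk, topLabel_strongColumn] at hg; cases hg
      · by_cases hji : j = i
        · exact hji ▸ hli
        by_cases h1 : Separates j (strongColumn D.ht) k
        · exact htr _ _ _ hli (hX.lt_of_separates_root hk hact h1 hji)
        · refine hX.lt_of_gapBetween q l j hql ?_
          unfold Separates at h1 hj
          unfold Between at hb
          unfold GapBetween
          omega
  subst hqr
  have hr := (strongColumn_spec D.ht).1
  have hkr : D.ht k + 1 = maxHeight D.ht := by rw [← hq.2.1, hr]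
  have hlast : ∀ l, Ahead (maxHeight D.ht) k l → D.ht l < maxHeight D.ht := fun l hl => by
    have h1 : Ahead (maxHeight D.ht) (strongColumn D.ht) k := by
      rw [← hkr]; exact ahead_succ.2 hq.1
    exact not_ahead_strongColumn _ (h1.trans hl)
  have hmE := maxHeight_addBlocks_one hkr
  have hadm : Admissible (addBlocks D.ht k 1) := by
    intro l hl
    rw [hmE] at hl
    have hlk : l ≠ k := fun e => by rw [e, addBlocks_apply, if_pos rfl] at hl; omega
    rw [addBlocks_apply, if_neg hlk] at hl ⊢
    obtain ⟨p, h1, h2⟩ := hc.admissible l hl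
    refine ⟨p, h1, h2.trans_le ?_⟩
    rw [addBlocks_apply]
    split_ifs with e
    · rw [e]; omega
    · rfl
  let E : Diagram t := Diagram.ofAdmissible _ hadm
  have hE : E.ht = addBlocks D.ht k 1 := rfl
  have hkE : strongColumn E.ht = k := strongColumn_addBlocks_one hkr hlast
  have hne : strongColumn D.ht ≠ k := fun e => by rw [e] at hr; omega
  have hvk : E.ht k = D.ht k + 1 := by rw [hE, addBlocks_apply, if_pos rfl]
  have hL : Link (H.mk D) (H.mk E) i := by
    refine ⟨D, E, k, rfl, rfl, D.complete_iff.2 hc, hc.reduced hlow, rfl, hne, hkE, ?_⟩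
    rw [hvk, E.admissible.entry_succ, if_pos hvk.ge, hE, state_addBlocks_one]
    exact hk
  refine ⟨H.mk E, ?_, hL⟩
  have hex := hL.exchange
  rw [show (H.mk E).index = k from hkE]
  refine hX.swap hk hact ?_ hex.right fun x h1 h2 => (hex.eq x h1 ?_).symm
  · exact (H.topLabel_eq_none_iff _).2 hkE.symm
  · rw [H.index_mk, hkE]; exact h2

/-! ### The graph of links -/

theorem entryFun_none (p : Fin (t + 1)) : entryFun (none : Option (Fin t)) p = 0 := rfl

theorem Exchange.toFun_sub {X Y : H t} {i : Fin t} (h : Exchange X Y i) :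
    X.toFun - Y.toFun = cr i X.index Y.index := by
  have h1 : X.toFun - Y.toFun = labelFun Y.topLabel - labelFun X.topLabel := by
    unfold H.toFun; abel
  have hX : X.topLabel X.index = none := X.topLabel_eq_none_iff.2 rfl
  have hY : Y.topLabel Y.index = none := Y.topLabel_eq_none_iff.2 rfl
  rw [h1, labelFun, labelFun, ← Finset.sum_sub_distrib, cr_eq,
    ← Finset.add_sum_erase _ _ (Finset.mem_univ X.index),
    ← Finset.add_sum_erase _ _ (Finset.mem_erase.2 ⟨h.ne.symm, Finset.mem_univ Y.index⟩),
    Finset.sum_eq_zero, h.left, h.right, hX, hY, entryFun_none, entryFun_none]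
  · abel
  · intro x hx
    simp only [Finset.mem_erase, Finset.mem_univ, and_true] at hx
    rw [h.eq x hx.2 hx.1, sub_self]

theorem Exchange.topLabel_right_of_ne {X Y : H t} {i j : Fin t} (h : Exchange X Y i)
    {x : Fin (t + 1)} (hx : X.topLabel x = some j) (hji : j ≠ i) : Y.topLabel x = some j := by
  rw [← h.eq x, hx]
  · intro e
    rw [X.topLabel_eq_none_iff.2 e] at hx
    cases hx
  · intro e
    rw [e, h.left] at hx
    exact hji (Option.some.inj hx).symm

theorem H.ext_castSucc {X Y : H t} (hX : ∀ g : Fin t, X.topLabel g.castSucc = some g)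
    (hY : ∀ g : Fin t, Y.topLabel g.castSucc = some g) : X = Y := by
  have hlast : ∀ Z : H t, (∀ g : Fin t, Z.topLabel g.castSucc = some g) →
      Z.topLabel (Fin.last t) = none := by
    intro Z hZ
    by_contra hc
    obtain ⟨g, hg⟩ := Option.ne_none_iff_exists'.1 hc
    exact (Fin.castSucc_ne_last g) (Z.topLabel_inj (hZ g) hg)
  refine H.ext_topLabel (funext fun x => ?_)
  refine Fin.lastCases ?_ (fun g => ?_) x
  · rw [hlast X hX, hlast Y hY]
  · rw [hX, hY]

section Sector

variable (lt : Fin t → Fin t → Prop)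

theorem sectorGraph_exchange {v w : (sectorGraph lt).V} {i : Fin t}
    (h : (sectorGraph lt).Edge v w i) : Exchange v.1 w.1 i := by
  rcases h with h | h
  · exact Link.exchange h
  · exact (Link.exchange h).symm

theorem sectorGraph_isEvaluation : (sectorGraph lt).IsEvaluation fun v => v.1.toFun :=
  fun _ _ _ h => (sectorGraph_exchange lt h).toFun_sub

theorem sectorGraph_p1 : (sectorGraph lt).P1 := fun _ _ _ h => (sectorGraph_exchange lt h).ne

theorem sectorGraph_p2 : (sectorGraph lt).P2 := by
  refine ⟨fun v w i i' h h' => ?_, fun v w w' i h h' => ?_⟩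
  · have h1 := (sectorGraph_exchange lt h).left
    rw [(sectorGraph_exchange lt h').left] at h1
    exact (Option.some.inj h1).symm
  · have e := sectorGraph_exchange lt h
    have e' := sectorGraph_exchange lt h'
    have hi : w.1.index = w'.1.index := v.1.topLabel_inj e.left e'.left
    refine Subtype.ext (H.ext_topLabel (funext fun x => ?_))
    by_cases h1 : x = v.1.index
    · rw [h1, e.right, e'.right]
    by_cases h2 : x = w.1.index
    · rw [w.1.topLabel_eq_none_iff.2 h2, w'.1.topLabel_eq_none_iff.2 (h2.trans hi)]
    · rw [← e.eq x h1 h2, ← e'.eq x h1 (hi ▸ h2)]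

/-- There is a path from `v` to `w` whose successive labels increase and belong to `S`. -/
def OrderedPathIn (S : Finset (Fin t)) (v w : (sectorGraph lt).V) : Prop :=
  ∃ (n : ℕ) (p : Fin (n + 1) → (sectorGraph lt).V) (u : Fin n → Fin t),
    p 0 = v ∧ p (Fin.last n) = w ∧ (∀ i, (sectorGraph lt).Edge (p i.castSucc) (p i.succ) (u i)) ∧
    (∀ a b, a < b → lt (u a) (u b)) ∧ ∀ a, u a ∈ S

theorem OrderedPathIn.cons {S S' : Finset (Fin t)} {v v' w : (sectorGraph lt).V} {i : Fin t}
    (hv : (sectorGraph lt).Edge v v' i) (hp : OrderedPathIn lt S' v' w) (hi : i ∈ S)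
    (hS : ∀ j ∈ S', j ∈ S ∧ lt i j) : OrderedPathIn lt S v w := by
  obtain ⟨n, p, u, h0, h1, h2, h3, h4⟩ := hp
  refine ⟨n + 1, Fin.cons v p, Fin.cons i u, rfl, ?_, fun j => ?_, fun a b hab => ?_, fun a => ?_⟩
  · rw [← Fin.succ_last, Fin.cons_succ, h1]
  · refine Fin.cases ?_ (fun j => ?_) j
    · simpa [h0] using hv
    · simpa [← Fin.succ_castSucc] using h2 j
  · refine Fin.cases (fun hab => ?_) (fun b hab => ?_) b hab
    · exact absurd hab (by simp)
    · refine Fin.cases (fun _ => ?_) (fun a hab => ?_) a hab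
      · simpa using (hS _ (h4 b)).2
      · simpa using h3 a b (Fin.succ_lt_succ_iff.1 hab)
  · refine Fin.cases ?_ (fun a => ?_) a
    · simpa using hi
    · simpa using (hS _ (h4 a)).1

theorem conditionS_of_orderedPath {v' v : (sectorGraph lt).V}
    (h : (sectorGraph lt).OrderedPath lt v' v) : ConditionS lt H.toFun v.1 v'.1 := by
  obtain ⟨n, p, u, rfl, rfl, h2, h3⟩ := h
  refine ⟨n, u, fun i => (p i).1.index, rfl, rfl, h3, ?_⟩
  have hterm : ∀ i : Fin n, cr (u i) (p i.castSucc).1.index (p i.succ).1.index =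
      (p i.castSucc).1.toFun - (p i.succ).1.toFun :=
    fun i => (sectorGraph_isEvaluation lt _ _ _ (h2 i)).symm
  simp only [hterm]
  clear hterm h2 h3
  induction n with
  | zero => simp
  | succ n ih =>
    rw [Fin.sum_univ_succ]
    have := ih (fun i => p i.succ) (fun i => u i.succ)
    simp only [Fin.succ_castSucc, Fin.succ_last] at this ⊢
    rw [← this]
    simp

/-- The class of the empty diagram. -/
def emptyVertex : (sectorGraph lt).V :=
  ⟨H.mk (Diagram.ofAdmissible (fun _ => 0) fun i hi => absurd hi (by simp [maxHeight])),
    Diagram.ofAdmissible (fun _ => 0) fun i hi => absurd hi (by simp [maxHeight]), rfl,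
    fun i hi => by
      obtain ⟨j, -, hj, -⟩ := canAdjoinDomino_iff.1 hi
      simp [Diagram.ofAdmissible] at hj,
    fun a b ⟨j, hj, _⟩ => absurd hj (by simp [Diagram.ofAdmissible, maxHeight])⟩

theorem topLabel_emptyVertex (g : Fin t) :
    (emptyVertex lt).1.topLabel g.castSucc = some g := by
  change state (fun _ => 0) 0 g.castSucc = some g
  rw [state, dif_neg (Fin.castSucc_ne_last g)]
  simp

/-- The vertices `v` and `w` lie in the same connected component. -/
def Connected (v w : (sectorGraph lt).V) : Prop :=
  Relation.ReflTransGen (fun x y => ∃ i, (sectorGraph lt).Edge x y i) v w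

theorem Connected.symm {v w : (sectorGraph lt).V} (h : Connected lt v w) : Connected lt w v := by
  have : Std.Symm fun x y => ∃ i, (sectorGraph lt).Edge x y i :=
    ⟨fun x y ⟨i, hi⟩ => ⟨i, (sectorGraph lt).symm _ _ _ hi⟩⟩
  exact Relation.ReflTransGen.stdSymm.symm _ _ h

/-- In a pointed chain the label `g` is used only in the step from `g + 1` to `g`, where it is found on the
column `g`; hence it is there from the start. -/
theorem topLabel_of_isPointedChain {C : Fin (t + 1) → (sectorGraph lt).V}
    (hC : (sectorGraph lt).IsPointedChain C) (g : Fin t) (k : Fin (t + 1)) (hk : g.val < k.val) :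
    (C k).1.topLabel g.castSucc = some g := by
  obtain ⟨hlab, hedge⟩ := hC
  induction k using Fin.induction with
  | zero => simp at hk
  | succ k ih =>
    have hex := sectorGraph_exchange lt (hedge k)
    have hl : (C k.castSucc).1.index = k.castSucc := hlab k.castSucc
    by_cases hgk : g = k
    · subst hgk
      rw [← hl]; exact hex.left
    · have : g.val ≠ k.val := fun e => hgk (Fin.ext e)
      rw [Fin.val_succ] at hk
      exact hex.symm.topLabel_right_of_ne (ih (by rw [Fin.val_castSucc]; omega)) hgk

/-- The vertex of the pointed chain with root `k`: the labels smaller than `k` in the usual order are to the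
left of their gaps and the other ones to the right. -/
def IsChainVertex (k : Fin (t + 1)) (v : (sectorGraph lt).V) : Prop :=
  v.1.index = k ∧ (∀ g : Fin t, g.val < k.val → v.1.topLabel g.castSucc = some g) ∧
    ∀ g : Fin t, k.val ≤ g.val → v.1.topLabel g.succ = some g

theorem IsChainVertex.eq {k : Fin (t + 1)} {v w : (sectorGraph lt).V} (hv : IsChainVertex lt k v)
    (hw : IsChainVertex lt k w) : v = w := by
  obtain ⟨h1, h2, h3⟩ := hv
  obtain ⟨h1', h2', h3'⟩ := hw
  refine Subtype.ext (H.ext_topLabel (funext fun x => ?_))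
  have hxt := x.isLt
  have hkt := k.isLt
  rcases lt_trichotomy x.val k.val with h | h | h
  · have hx : x = (⟨x.val, by omega⟩ : Fin t).castSucc := rfl
    rw [hx, h2 _ h, h2' _ h]
  · have hx : x = k := Fin.ext h
    rw [v.1.topLabel_eq_none_iff.2 (hx.trans h1.symm),
      w.1.topLabel_eq_none_iff.2 (hx.trans h1'.symm)]
  · have hx : x = (⟨x.val - 1, by omega⟩ : Fin t).succ := Fin.ext (by simp only [Fin.val_succ]; omega)
    rw [hx, h3 _ (by simp only; omega), h3' _ (by simp only; omega)]

variable [IsStrictTotalOrder (Fin t) lt]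

theorem heapLabelling_of_vertex (v : (sectorGraph lt).V) :
    HeapLabelling lt v.1.topLabel v.1.index :=
  (mem_HSector_iff (lt := lt) fun _ _ _ => trans_of lt).1 v.2

theorem exists_edge (v : (sectorGraph lt).V) {i : Fin t}
    (hact : ∀ j, GapBetween v.1.index i j → lt i j) :
    ∃ w, (sectorGraph lt).Edge v w i := by
  obtain ⟨Y, hY, hL⟩ := exists_link (heapLabelling_of_vertex lt v) hact
  exact ⟨⟨Y, (mem_HSector_iff (lt := lt) fun _ _ _ => trans_of lt).2 hY⟩, Or.inl hL⟩

/-- The gaps strictly between the root and the gap of the label of an edge are larger than that label. -/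
theorem lt_of_edge {v w : (sectorGraph lt).V} {i : Fin t} (h : (sectorGraph lt).Edge v w i) {j : Fin t}
    (hj : GapBetween v.1.index i j) : lt i j :=
  (heapLabelling_of_vertex lt w).lt_of_gapBetween _ _ _ (sectorGraph_exchange lt h).right hj

theorem separates_of_edge {v w : (sectorGraph lt).V} {i : Fin t}
    (h : (sectorGraph lt).Edge v w i) : Separates i v.1.index w.1.index :=
  (heapLabelling_of_vertex lt v).separates_root (sectorGraph_exchange lt h).left
    fun _ => lt_of_edge lt h

theorem lt_of_separates_edge {v w : (sectorGraph lt).V} {i j : Fin t}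
    (h : (sectorGraph lt).Edge v w i) (hj : Separates j v.1.index w.1.index) (hji : j ≠ i) :
    lt i j :=
  (heapLabelling_of_vertex lt v).lt_of_separates_root (sectorGraph_exchange lt h).left
    (fun _ => lt_of_edge lt h) hj hji

/-! ### Triads -/

/-- Triads join vertices with the same label at their ends, and their order lifts to that of the sector. -/
theorem sectorGraph_triad {a b c d : (sectorGraph lt).V} {i k : Fin t}
    (h : (sectorGraph lt).Triad a b c d i k) : a.1.index = d.1.index ∧ lt i k := by
  obtain ⟨hnd, hab, hbc, hcd⟩ := h
  have eab := sectorGraph_exchange lt hab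
  have ebc := sectorGraph_exchange lt hbc
  have ecd := sectorGraph_exchange lt hcd
  have hik : i ≠ k := by
    rintro rfl
    have : a = c := (sectorGraph_p2 lt).2 b a c i ((sectorGraph lt).symm _ _ _ hab) hbc
    subst this
    simp at hnd
  have hda : a.1.index = d.1.index :=
    c.1.topLabel_inj (ebc.topLabel_right_of_ne eab.right hik) ecd.left
  refine ⟨hda, ?_⟩
  -- the root moves across the gap of `i`, across that of `k`, and back across that of `i`
  have s1 := separates_of_edge lt hab
  have s2 := separates_of_edge lt hbc
  have s3 := separates_of_edge lt hcd
  have hik' : k.val ≠ i.val := fun e => hik (Fin.ext e.symm)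
  by_cases h1 : Separates k a.1.index b.1.index
  · exact lt_of_separates_edge lt hab h1 (Ne.symm hik)
  · refine lt_of_separates_edge lt hcd ?_ (Ne.symm hik)
    rw [← hda]
    unfold Separates at *
    omega

/-! ### Ordered paths -/

theorem exists_minimal_gap {r k : Fin (t + 1)} (hrk : r ≠ k) : ∃ i : Fin t, Separates i r k ∧
    ∀ j, Separates j r k → j ≠ i → lt i j := by
  have hne : ∃ i : Fin t, Separates i r k := by
    have hv : r.val ≠ k.val := fun e => hrk (Fin.ext e)
    refine ⟨⟨min r.val k.val, by omega⟩, ?_⟩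
    unfold Separates
    simp only
    omega
  obtain ⟨i, hi, hmin⟩ := (Finite.wellFounded_of_trans_of_irrefl lt).has_min
    {i | Separates i r k} hne
  refine ⟨i, hi, fun j hj hji => ?_⟩
  rcases trichotomous_of lt i j with h | h | h
  · exact h
  · exact absurd h.symm hji
  · exact absurd h (hmin j hj)

/-- The smallest gap between the root and the column `k` can be crossed, and only larger gaps are left
between the new root and `k`. -/
theorem exists_edge_towards (v : (sectorGraph lt).V) {k : Fin (t + 1)} (hk : v.1.index ≠ k) :
    ∃ i w, (sectorGraph lt).Edge v w i ∧ Separates i v.1.index k ∧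
      (∀ j, Separates j v.1.index k → j ≠ i → lt i j) ∧ ∀ j, Separates j w.1.index k → lt i j := by
  obtain ⟨i, hi, hmin⟩ := exists_minimal_gap lt hk
  obtain ⟨w, hw⟩ := exists_edge lt v (i := i) fun j hj => hmin j
    (by unfold GapBetween at hj; unfold Separates at *; omega)
    (by rintro rfl; unfold GapBetween at hj; omega)
  refine ⟨i, w, hw, hi, hmin, fun j hj => ?_⟩
  have hs := separates_of_edge lt hw
  have hji : j ≠ i := by
    rintro rfl
    unfold Separates at *
    omega
  by_cases h1 : Separates j v.1.index k
  · exact hmin j h1 hji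
  · refine lt_of_separates_edge lt hw ?_ hji
    unfold Separates at *
    omega

/-- The root can be moved to any column by crossing the smallest remaining gap at each step. -/
theorem exists_orderedPathIn (S : Finset (Fin t)) (hup : ∀ i ∈ S, ∀ j, lt i j → j ∈ S)
    (v : (sectorGraph lt).V) (k : Fin (t + 1)) (hS : ∀ j, Separates j v.1.index k → j ∈ S) :
    ∃ w, w.1.index = k ∧ OrderedPathIn lt S v w := by
  classical
  induction S using Finset.strongInduction generalizing v with
  | H S ih =>
    by_cases hk : v.1.index = k
    · exact ⟨v, hk, 0, fun _ => v, Fin.elim0, rfl, rfl, fun i => i.elim0, fun a => a.elim0,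
        fun a => a.elim0⟩
    · obtain ⟨i, w, hw, hi, -, hlt⟩ := exists_edge_towards lt v hk
      have hiS := hS i hi
      obtain ⟨w', h1, h2⟩ := ih (S.filter fun j => lt i j)
        (Finset.filter_ssubset.2 ⟨i, hiS, irrefl_of lt i⟩)
        (fun j hj l hl => by
          rw [Finset.mem_filter] at hj ⊢
          exact ⟨hup j hj.1 l hl, trans_of lt hj.2 hl⟩) w
        (fun j hj => Finset.mem_filter.2 ⟨hup i hiS j (hlt j hj), hlt j hj⟩)
      exact ⟨w', h1, h2.cons lt hw hiS fun j hj => Finset.mem_filter.1 hj⟩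

theorem sectorGraph_p7 : (sectorGraph lt).P7 lt := by
  intro v k
  obtain ⟨w, hw, n, p, u, h0, h1, h2, h3, -⟩ := exists_orderedPathIn lt Finset.univ
    (fun _ _ _ _ => Finset.mem_univ _) v k (fun _ _ => Finset.mem_univ _)
  exact ⟨w, hw, n, p, u, h0, h1, h2, h3⟩

/-! ### Connectedness -/

/-- Let `N` be the largest coefficient outside an upper set `U` of coefficients all of which label their
own columns, and suppose that `N` does not label its own column.  Then the root can be moved to that column
along labels smaller than `N`. -/
theorem exists_connected_index {U : Finset (Fin t)} (hU : ∀ i ∈ U, ∀ j, lt i j → j ∈ U) {N : Fin t}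
    (hN : N ∉ U) (hNU : ∀ j, lt N j → j ∈ U) {x : Fin (t + 1)} (hx : x ≠ N.castSucc)
    (S : Finset (Fin t)) (v : (sectorGraph lt).V)
    (hS : ∀ j, Separates j v.1.index N.castSucc → j ∈ S) (hup : ∀ i ∈ S, ∀ j, lt i j → j ∈ S)
    (hv : ∀ M ∈ U, v.1.topLabel M.castSucc = some M) (hvx : v.1.topLabel x = some N) :
    ∃ w, Connected lt v w ∧ (∀ M ∈ U, w.1.topLabel M.castSucc = some M) ∧
      w.1.topLabel x = some N ∧ w.1.index = N.castSucc := by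
  classical
  induction S using Finset.strongInduction generalizing v with
  | H S ih =>
    by_cases hk : v.1.index = N.castSucc
    · exact ⟨v, Relation.ReflTransGen.refl, hv, hvx, hk⟩
    obtain ⟨i, w, hw, hi, hmin, hlt⟩ := exists_edge_towards lt v hk
    have hiS := hS i hi
    have hH := heapLabelling_of_vertex lt v
    -- a column other than `x` whose gap lies in `U` carries its own label, and so is not the root
    have hown : ∀ y : Fin (t + 1), ∀ hy : y.val < t, (⟨y.val, hy⟩ : Fin t) ∈ U →
        y ≠ v.1.index ∧ y ≠ x := by
      intro y hy hyU
      have h1 : v.1.topLabel y = some ⟨y.val, hy⟩ := hv _ hyU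
      refine ⟨fun e => ?_, fun e => ?_⟩
      · rw [v.1.topLabel_eq_none_iff.2 e] at h1; cases h1
      · have h2 : v.1.topLabel y = some N := by rw [e]; exact hvx
        rw [h1, Option.some.injEq] at h2
        have h3 : y.val = N.val := congrArg Fin.val h2
        exact hx (Fin.ext (by rw [← e]; exact h3))
    have hrt := v.1.index.isLt
    have hxt := x.isLt
    have hxr : x.val ≠ v.1.index.val := fun e => by
      rw [v.1.topLabel_eq_none_iff.2 (Fin.ext e)] at hvx; cases hvx
    have hxN : x.val ≠ N.val := fun e => hx (Fin.ext e)
    have hiU : i ∉ U := by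
      intro hiU
      have hall : ∀ j, Separates j v.1.index N.castSucc → j ∈ U := fun j hj => by
        by_cases hji : j = i
        · exact hji ▸ hiU
        · exact hU i hiU j (hmin j hj hji)
      unfold Separates at hall hi
      simp only [Fin.val_castSucc] at hall hi
      by_cases hrN : v.1.index.val < N.val
      · have hrt' : v.1.index.val < t := by omega
        exact (hown v.1.index hrt' (hall _ (Or.inl ⟨le_rfl, hrN⟩))).1 rfl
      · exact hN (hall N (Or.inr ⟨le_rfl, by omega⟩))
    have hiN : i ≠ N := by
      rintro rfl
      unfold Separates at hi hmin
      simp only [Fin.val_castSucc] at hi hmin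
      have hlt' := fun j => hH.lt_of_gapBetween x i j hvx
      unfold GapBetween at hlt'
      rcases lt_trichotomy x.val i.val with h | h | h
      · exact (hown x (by omega) (hNU _ (hlt' _ (Or.inl ⟨le_rfl, h⟩)))).2 rfl
      · exact hxN h
      · by_cases hxr' : x.val < v.1.index.val
        · refine (hown x (by omega) (hNU _ (hmin _ (Or.inr ⟨h.le, hxr'⟩) fun e => ?_))).2 rfl
          exact hxN (congrArg Fin.val e)
        · exact (hown v.1.index (by omega) (hNU _ (hlt' ⟨v.1.index.val, by omega⟩
            (Or.inr ⟨by simp only; omega, by simp only; omega⟩)))).1 rfl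
    have hex := sectorGraph_exchange lt hw
    obtain ⟨w', h1, h2⟩ := ih (S.filter fun j => lt i j)
      (Finset.filter_ssubset.2 ⟨i, hiS, irrefl_of lt i⟩) w
      (fun j hj => Finset.mem_filter.2 ⟨hup i hiS j (hlt j hj), hlt j hj⟩)
      (fun j hj l hl => by
        rw [Finset.mem_filter] at hj ⊢
        exact ⟨hup j hj.1 l hl, trans_of lt hj.2 hl⟩)
      (fun M hM => hex.topLabel_right_of_ne (hv M hM) fun e => hiU (e ▸ hM))
      (hex.topLabel_right_of_ne hvx hiN.symm)
    exact ⟨w', Relation.ReflTransGen.head ⟨i, hw⟩ h1, h2⟩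

/-- The labels are put on their own columns one after the other, the largest first. -/
theorem connected_emptyVertex (U : Finset (Fin t)) (hU : ∀ i ∈ U, ∀ j, lt i j → j ∈ U)
    (v : (sectorGraph lt).V) (hv : ∀ M ∈ U, v.1.topLabel M.castSucc = some M) :
    Connected lt v (emptyVertex lt) := by
  classical
  induction hn : Uᶜ using Finset.strongInduction generalizing U v with
  | H V ih =>
    subst hn
    by_cases hne : ∃ N, N ∉ U
    · obtain ⟨N, hN, hmax⟩ := (Finite.wellFounded_of_trans_of_irrefl (Function.swap lt)).has_min
        {N | N ∉ U} hne
      have hNU : ∀ j, lt N j → j ∈ U := fun j hj => by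
        by_contra hc
        exact hmax j hc hj
      have hN' : N ∉ U := hN
      have hU' : ∀ i ∈ insert N U, ∀ j, lt i j → j ∈ insert N U := by
        intro i hi j hj
        rcases Finset.mem_insert.1 hi with rfl | hi
        · exact Finset.mem_insert_of_mem (hNU j hj)
        · exact Finset.mem_insert_of_mem (hU i hi j hj)
      have hss : (insert N U)ᶜ ⊂ Uᶜ := Finset.compl_ssubset_compl.2 (Finset.ssubset_insert hN')
      obtain ⟨x, hx⟩ := (heapLabelling_of_vertex lt v).surj N
      by_cases hxN : x = N.castSucc
      · refine ih _ hss (insert N U) hU' v (fun M hM => ?_) rfl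
        rcases Finset.mem_insert.1 hM with rfl | hM
        · rw [← hxN, hx]
        · exact hv M hM
      · obtain ⟨w, h1, h2, h3, h4⟩ := exists_connected_index lt hU hN' hNU hxN Finset.univ v
          (fun _ _ => Finset.mem_univ _) (fun _ _ _ _ => Finset.mem_univ _) hv hx
        obtain ⟨w', hw'⟩ := exists_edge lt w (i := N) fun j hj => by
          rw [h4] at hj
          unfold GapBetween at hj
          simp only [Fin.val_castSucc] at hj
          omega
        have hex := sectorGraph_exchange lt hw'
        refine (h1.tail ⟨N, hw'⟩).trans (ih _ hss (insert N U) hU' w' (fun M hM => ?_) rfl)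
        rcases Finset.mem_insert.1 hM with rfl | hM
        · rw [← h4, hex.right]
        · exact hex.topLabel_right_of_ne (h2 M hM) fun e => hN' (e ▸ hM)
    · push Not at hne
      have : v = emptyVertex lt :=
        Subtype.ext (H.ext_castSucc (fun g => hv g (hne g)) (topLabel_emptyVertex lt))
      rw [this]
      exact Relation.ReflTransGen.refl

theorem sectorGraph_p5 : (sectorGraph lt).P5 := by
  refine ⟨⟨emptyVertex lt⟩, fun v w => ?_⟩
  have h : ∀ v, Connected lt v (emptyVertex lt) := fun v =>
    connected_emptyVertex lt ∅ (by simp) v (by simp)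
  exact (h v).trans ((h w).symm lt)

/-! ### The pointed chain -/

theorem IsChainVertex.exists_edge {k : Fin t} {v : (sectorGraph lt).V}
    (hv : IsChainVertex lt k.succ v) :
    ∃ w, (sectorGraph lt).Edge v w k ∧ IsChainVertex lt k.castSucc w := by
  obtain ⟨h1, h2, h3⟩ := hv
  obtain ⟨w, hw⟩ := Preparation.exists_edge lt v (i := k) fun j hj => by
    rw [h1] at hj
    unfold GapBetween at hj
    simp only [Fin.val_succ] at hj
    omega
  have hex := sectorGraph_exchange lt hw
  refine ⟨w, hw, v.1.topLabel_inj hex.left (h2 k (by simp)), fun g hg => ?_, fun g hg => ?_⟩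
  · rw [Fin.val_castSucc] at hg
    exact hex.topLabel_right_of_ne (h2 g (by rw [Fin.val_succ]; omega)) (Fin.ne_of_val_ne hg.ne)
  · rw [Fin.val_castSucc] at hg
    by_cases hgk : g = k
    · subst hgk; rw [← h1, hex.right]
    · have : g.val ≠ k.val := fun e => hgk (Fin.ext e)
      exact hex.topLabel_right_of_ne (h3 g (by rw [Fin.val_succ]; omega)) hgk

theorem exists_isChainVertex (k : Fin (t + 1)) : ∃ v, IsChainVertex lt k v := by
  induction k using Fin.reverseInduction with
  | last =>
    refine ⟨emptyVertex lt, ?_, fun g _ => topLabel_emptyVertex lt g, fun g hg => ?_⟩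
    · refine Fin.lastCases (motive := fun x => (emptyVertex lt).1.index = x → x = Fin.last t)
        (fun _ => rfl) (fun g hg => ?_) (emptyVertex lt).1.index rfl
      have h1 := topLabel_emptyVertex lt g
      rw [(emptyVertex lt).1.topLabel_eq_none_iff.2 hg.symm] at h1
      cases h1
    · have := g.isLt
      rw [Fin.val_last] at hg
      omega
  | cast k ih =>
    obtain ⟨v, hv⟩ := ih
    obtain ⟨w, -, hw⟩ := hv.exists_edge
    exact ⟨w, hw⟩

theorem sectorGraph_p4 : (sectorGraph lt).P4 := by
  choose C hC using exists_isChainVertex lt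
  have hchain : (sectorGraph lt).IsPointedChain C := by
    refine ⟨fun k => (hC k).1, fun k => ?_⟩
    obtain ⟨w, hw, hwk⟩ := (hC k.succ).exists_edge
    exact (hC k.castSucc).eq lt hwk ▸ hw
  refine ⟨C, hchain, fun C' hC' => funext fun k => ?_⟩
  induction k using Fin.reverseInduction with
  | last =>
    exact Subtype.ext (H.ext_castSucc
      (fun g => topLabel_of_isPointedChain lt hC' g _ (by simp))
      (fun g => topLabel_of_isPointedChain lt hchain g _ (by simp)))
  | cast k ih =>
    refine (sectorGraph_p2 lt).2 (C k.succ) _ _ k ?_ (hchain.2 k)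
    rw [← ih]
    exact hC'.2 k

theorem sectorGraph_isSGraph : (sectorGraph lt).IsSGraph lt where
  p1 := sectorGraph_p1 lt
  p2 := sectorGraph_p2 lt
  p3 := ⟨_, sectorGraph_isEvaluation lt⟩
  p4 := sectorGraph_p4 lt
  p5 := sectorGraph_p5 lt
  p6 _ _ _ _ _ _ h := (sectorGraph_triad lt h).1
  order _ _ _ _ _ _ h := (sectorGraph_triad lt h).2
  p7 := sectorGraph_p7 lt

end Sector

end Preparation

theorem theorem8p6 (t : ℕ) (lt : Fin t → Fin t → Prop) (hlt : IsStrictTotalOrder (Fin t) lt) :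
    ∃ F : Preparation.H t → Preparation.Bilin t,
      (∀ D : Preparation.Diagram t, F (Preparation.H.mk D) = D.toFun) ∧
      (∀ X' ∈ Preparation.HSector lt, ∀ k : Fin (t + 1),
        ∃ X ∈ Preparation.HSector lt, X.index = k ∧ Preparation.ConditionS lt F X X') ∧
      (Preparation.sectorGraph lt).IsEvaluation (fun v => F v.1) ∧
      (Preparation.sectorGraph lt).IsSGraph lt := by
  refine ⟨Preparation.H.toFun, Preparation.H.toFun_mk, fun X' hX' k => ?_,
    Preparation.sectorGraph_isEvaluation lt, Preparation.sectorGraph_isSGraph lt⟩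
  obtain ⟨v, hv, hp⟩ := Preparation.sectorGraph_p7 lt ⟨X', hX'⟩ k
  exact ⟨v.1, v.2, hv, Preparation.conditionS_of_orderedPath lt hp⟩
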